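/- We work in continuous first order logic. Let $\mathcal M$ be a structure (a non-empty complete metric space of diameter at most $1$, with predicates valued in $[0,1]$ and functions that respect prescribed moduli of uniform continuity), let $A\subseteq M$, and assume that $\mathcal M$ is $(|A|+\aleph_0)^+$-saturated. Let $X\subseteq M^n$ be type-definable over $A$, i.e. the set of realisations of a set of conditions $\varphi(\bar x)=0$ with $\varphi$ a formula over $A$. A (total) definable predicate over $A$ is a uniform limit of formulas with parameters in $A$. A partial definable (pseudo-)metric on $X$ over $A$ is a (pseudo-)metric $d\colon X\times X\to[0,1]$ which is the restriction to $X\times X$ of a definable predicate over $A$ on $M^n\times M^n$; it is total if $X=M^n$. **Theorem.** Let $d_1$ be a partial definable pseudo-metric (respectively, metric) on $X$ over $A$. Then there exist a total definable pseudo-metric (respectively, metric) $d_2$ on $M^n$ over $A$ and a continuous non-decreasing function $h\colon[0,1]\to[0,1]$ with $h(0)=0$ and $h(t)\ge t$ for all $t\in[0,1]$, such that $d_2$ extends $h\circ d_1$, i.e. $d_2(x,y)=h(d_1(x,y))$ for all $x,y\in X$. -/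

import Mathlib

/-!
Continuous first order logic, in one sort, with truth values in the unit interval
(`0` is true, `1` is false).
-/

universe u v w

namespace ContLogic

/-- A continuous signature: function and predicate symbols of every finite arity, each of them
equipped with a modulus of uniform continuity `ε ↦ δ`.  The symbol for the metric is not listed,
it belongs to the logic. -/
structure Signature where
  Func : ℕ → Type u
  Pred : ℕ → Type v
  funcModulus : ∀ {k : ℕ}, Func k → ℝ → ℝ
  predModulus : ∀ {k : ℕ}, Pred k → ℝ → ℝ
  funcModulus_pos : ∀ {k : ℕ} (f : Func k) (ε : ℝ), 0 < ε → 0 < funcModulus f ε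
  predModulus_pos : ∀ {k : ℕ} (P : Pred k) (ε : ℝ), 0 < ε → 0 < predModulus P ε

/-- A structure for the signature `L`: a non-empty complete metric space of diameter at most one,
where the symbols are interpreted by functions `M ^ k → M` and `M ^ k → [0, 1]` that respect the
moduli of uniform continuity (`M ^ k` carries the maximum metric). -/
class Structure (L : Signature.{u, v}) (M : Type w) [MetricSpace M] where
  nonempty : Nonempty M
  complete : CompleteSpace M
  dist_le_one : ∀ x y : M, dist x y ≤ 1
  func : ∀ {k : ℕ}, L.Func k → (Fin k → M) → M
  pred : ∀ {k : ℕ}, L.Pred k → (Fin k → M) → unitInterval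
  func_modulus : ∀ {k : ℕ} (f : L.Func k) (ε : ℝ), 0 < ε → ∀ x y : Fin k → M,
    dist x y < L.funcModulus f ε → dist (func f x) (func f y) ≤ ε
  pred_modulus : ∀ {k : ℕ} (P : L.Pred k) (ε : ℝ), 0 < ε → ∀ x y : Fin k → M,
    dist x y < L.predModulus P ε → dist (pred P x) (pred P y) ≤ ε

/-- Terms with variables in `α`. -/
inductive Term (L : Signature.{u, v}) (α : Type w) : Type (max u w)
  | var (a : α) : Term L α
  | func {k : ℕ} (f : L.Func k) (ts : Fin k → Term L α) : Term L α

/-- Formulas whose variables are the free variables in `α` and `m` further variables, which are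
the ones that quantifiers bind.  The connectives are all the continuous functions
`[0, 1] ^ k → [0, 1]`; the quantifiers are `sup` and `inf`, and bind the last variable. -/
inductive Formula (L : Signature.{u, v}) (α : Type w) : ℕ → Type (max u v w)
  | pred {m k : ℕ} (P : L.Pred k) (ts : Fin k → Term L (α ⊕ Fin m)) : Formula L α m
  | metric {m : ℕ} (t s : Term L (α ⊕ Fin m)) : Formula L α m
  | conn {m k : ℕ} (c : C(Fin k → unitInterval, unitInterval))
      (φs : Fin k → Formula L α m) : Formula L α m
  | sup {m : ℕ} (φ : Formula L α (m + 1)) : Formula L α m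
  | inf {m : ℕ} (φ : Formula L α (m + 1)) : Formula L α m

section Semantics

variable {L : Signature.{u, v}} {M : Type w} [MetricSpace M] [Structure L M]

/-- The value of a term. -/
def Term.eval {α : Type*} (e : α → M) : Term L α → M
  | .var a => e a
  | .func f ts => Structure.func f (fun i => (ts i).eval e)

/-- The truth value of a formula, where `e` and `b` assign elements of `M` to the variables. -/
noncomputable def Formula.eval {α : Type*} (e : α → M) :
    {m : ℕ} → Formula L α m → (Fin m → M) → unitInterval
  | _, .pred P ts, b => Structure.pred P (fun i => (ts i).eval (Sum.elim e b))
  | _, .metric t s, b =>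
      ⟨dist (t.eval (Sum.elim e b)) (s.eval (Sum.elim e b)),
        dist_nonneg, Structure.dist_le_one L _ _⟩
  | _, .conn c φs, b => c (fun i => (φs i).eval e b)
  | _, .sup φ, b => ⨆ a : M, φ.eval e (Fin.snoc b a)
  | _, .inf φ, b => ⨅ a : M, φ.eval e (Fin.snoc b a)

variable (L)

/-- Formulas with parameters in `A` and free variables in `ι`. -/
abbrev FormulaOver (A : Set M) (ι : Type) : Type (max u v w) := Formula L (A ⊕ ι) 0

variable {L}

/-- The truth value of a formula with parameters, where every parameter denotes itself. -/
noncomputable def FormulaOver.val {A : Set M} {ι : Type} (φ : FormulaOver L A ι)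
    (x : ι → M) : unitInterval :=
  Formula.eval (Sum.elim (fun a : A => (a : M)) x) φ Fin.elim0

variable (L)

/-- `κ`-saturation: over fewer than `κ` parameters, every set of conditions `φ = 0` in finitely
many variables that is finitely approximately satisfiable in `M` (that is, consistent with the
theory of `M` with the parameters named) is realised in `M`. -/
def IsSaturated (M : Type w) [MetricSpace M] [Structure L M] (κ : Cardinal.{w}) : Prop :=
  ∀ A : Set M, Cardinal.mk A < κ → ∀ (n : ℕ) (Γ : Set (FormulaOver L A (Fin n))),
    (∀ F : Finset (FormulaOver L A (Fin n)), (F : Set (FormulaOver L A (Fin n))) ⊆ Γ →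
      ∀ ε : ℝ, 0 < ε → ∃ x : Fin n → M, ∀ φ ∈ F, (φ.val x : ℝ) ≤ ε) →
    ∃ x : Fin n → M, ∀ φ ∈ Γ, φ.val x = 0

/-- `X` is type-definable over `A`: it is the set of realisations of a set of conditions
`φ = 0`, with `φ` a formula over `A`. -/
def IsTypeDefinable (A : Set M) {n : ℕ} (X : Set (Fin n → M)) : Prop :=
  ∃ Γ : Set (FormulaOver L A (Fin n)), X = {x | ∀ φ ∈ Γ, φ.val x = 0}

/-- `P` is a (total) definable predicate over `A`: a uniform limit of formulas over `A`. -/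
def IsDefinablePredicate (A : Set M) {ι : Type} (P : (ι → M) → unitInterval) : Prop :=
  ∀ ε : ℝ, 0 < ε → ∃ φ : FormulaOver L A ι, ∀ x : ι → M, dist (P x) (φ.val x) ≤ ε

/-- A definable predicate over `A` in two `n`-tuples of variables. -/
def IsDefinableBinary (A : Set M) {n : ℕ}
    (P : (Fin n → M) → (Fin n → M) → unitInterval) : Prop :=
  IsDefinablePredicate L A
    (fun z : Fin n ⊕ Fin n → M => P (fun i => z (Sum.inl i)) (fun i => z (Sum.inr i)))

/-- A partial predicate on `X × X` is definable over `A` if it is the restriction of a total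
definable predicate over `A`. -/
def IsPartialDefinableBinary (A : Set M) {n : ℕ} {X : Set (Fin n → M)}
    (p : X → X → unitInterval) : Prop :=
  ∃ P : (Fin n → M) → (Fin n → M) → unitInterval,
    IsDefinableBinary L A P ∧ ∀ x y : X, P x y = p x y

end Semantics

/-- A `[0, 1]`-valued pseudo-metric. -/
structure IsPseudoMetric {Y : Type*} (d : Y → Y → unitInterval) : Prop where
  self : ∀ x, d x x = 0
  comm : ∀ x y, d x y = d y x
  triangle : ∀ x y z, (d x z : ℝ) ≤ (d x y : ℝ) + (d y z : ℝ)

/-- A `[0, 1]`-valued metric. -/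
structure IsMetric {Y : Type*} (d : Y → Y → unitInterval) : Prop extends IsPseudoMetric d where
  eq_of_zero : ∀ x y, d x y = 0 → x = y

end ContLogic

/-! The theorem holds with `h = id`: the given pseudo-metric itself extends. Let `P` be a symmetric
definable predicate restricting to it. Off `X` the triangle inequality may fail for `P`, but by
saturation it fails only slightly near `X`. Countably many such estimates are packed into one
definable `θ` that vanishes on `X`: where `θ ≤ t < 1`, the defect of `P` is at most `t ^ 2`
(`IsSaturated.exists_triangle_defect_le_sq`).

Let `σ` be a definable pseudo-metric for which `P` and `θ` are Lipschitz (`stepDist`). A step from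
`x` to `y` has length `Q(x, y)`, the least of `1`, `σ(x, y)` and `P(x, y) + θ(x) + θ(y)`. A step of
the last kind is at least as long as `θ` at its ends, so the triangle defect of `Q` is quadratic in
the step lengths (`isAlmostPseudoMetric_stepLength`). The extension is the infimum of the
`Q`-lengths of all chains.

Definability is the crux, as the number of steps is unbounded. A chain of `m + 2` steps and length
below `1` has two consecutive steps of size `O(1/m)`; merging them costs `O(1/m²)`. These costs are
summable, so chains of `m + 1` steps come within `8 / (m + 1)` of the infimum, uniformly
(`IsAlmostPseudoMetric.chainInf_le_chainDist_add`).

On `X` one step gives at most `P`. Conversely `P(x, ·)` is `1`-Lipschitz for `Q` when `θ(x) = 0`, so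
no chain beats `P`. For metrics, merging a chain of length about `s` costs only `O(s²)`, so distance
`0` forces `Q = 0`. Then either `σ = 0`, and `σ` dominates the metric of the structure, or `P`
vanishes at two zeros of `θ`; saturation provides a `θ` on whose zeros `P` separates points. -/

namespace ContLogic

/-! ### Substitution of variables and quantification over tuples -/

section Substitution

variable {L : Signature.{u, v}} {M : Type w} [MetricSpace M] [Structure L M]

/-- Renaming the variables of a term. -/
def Term.rename {α β : Type*} (f : α → β) : Term L α → Term L β
  | .var a => .var (f a)
  | .func g ts => .func g (fun i => (ts i).rename f)

theorem Term.eval_rename {α β : Type*} (f : α → β) (e : β → M) (t : Term L α) :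
    (t.rename f).eval e = t.eval (e ∘ f) := by
  induction t with
  | var a => rfl
  | func g ts ih => simp only [Term.rename, Term.eval, ih]

/-- The renaming of variables behind `Formula.bind`. -/
def bindVar {α β : Type*} {n : ℕ} (f : α → β ⊕ Fin n) (m : ℕ) :
    α ⊕ Fin m → β ⊕ Fin (n + m) :=
  Sum.elim (fun a => Sum.map id (Fin.castAdd m) (f a)) (fun j => Sum.inr (Fin.natAdd n j))

/-- Renaming the free variables of a formula, where some of them may become
bindable variables. -/
def Formula.bind {α β : Type*} {n : ℕ} (f : α → β ⊕ Fin n) :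
    {m : ℕ} → Formula L α m → Formula L β (n + m)
  | m, .pred P ts => .pred P (fun i => (ts i).rename (bindVar f m))
  | m, .metric t s => .metric (t.rename (bindVar f m)) (s.rename (bindVar f m))
  | _, .conn c φs => .conn c (fun i => (φs i).bind f)
  | _, .sup φ => .sup (φ.bind f)
  | _, .inf φ => .inf (φ.bind f)

theorem elim_comp_bindVar {M : Type*} {α β : Type*} {n m : ℕ} (f : α → β ⊕ Fin n) (e : β → M)
    (y : Fin n → M) (b : Fin m → M) :
    Sum.elim e (Fin.append y b) ∘ bindVar f m = Sum.elim (Sum.elim e y ∘ f) b := by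
  funext a
  rcases a with a | j
  · rcases h : f a with c | i <;> simp [bindVar, h]
  · simp [bindVar]

/-- The new variables are placed before the old bindable ones. Quantifiers bind the last variable,
so they commute with this insertion. -/
theorem Formula.eval_bind {α β : Type*} {n : ℕ} (f : α → β ⊕ Fin n) (e : β → M)
    (y : Fin n → M) {m : ℕ} (φ : Formula L α m) (b : Fin m → M) :
    (φ.bind f).eval e (Fin.append y b) = φ.eval (Sum.elim e y ∘ f) b := by
  induction φ with
  | pred P ts => simp only [Formula.bind, Formula.eval, Term.eval_rename, elim_comp_bindVar]
  | metric t s => simp only [Formula.bind, Formula.eval, Term.eval_rename, elim_comp_bindVar]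
  | conn c φs ih => simp only [Formula.bind, Formula.eval, ih]
  | sup φ ih => simp only [Formula.bind, Formula.eval, ← Fin.append_snoc, ih]
  | inf φ ih => simp only [Formula.bind, Formula.eval, ← Fin.append_snoc, ih]

/-- Binding all bindable variables by infima. -/
def Formula.infAll {α : Type*} : {n : ℕ} → Formula L α n → Formula L α 0
  | 0, φ => φ
  | _ + 1, φ => φ.inf.infAll

theorem Formula.eval_infAll {α : Type*} (e : α → M) {n : ℕ} (φ : Formula L α n) :
    φ.infAll.eval e Fin.elim0 = ⨅ y : Fin n → M, φ.eval e y := by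
  induction n with
  | zero =>
    rw [iInf_unique]
    exact congrArg _ (Subsingleton.elim _ _)
  | succ n ih =>
    rw [Formula.infAll, ih]
    simp only [Formula.eval]
    apply le_antisymm
    · refine le_iInf fun y => (iInf_le _ (Fin.init y)).trans ?_
      refine (iInf_le _ (y (Fin.last n))).trans ?_
      rw [Fin.snoc_init_self]
    · exact le_iInf fun y => le_iInf fun a => iInf_le _ _

variable {A : Set M}

theorem exists_val_rename {ι κ : Type} (f : ι → κ) (φ : FormulaOver L A ι) :
    ∃ ψ : FormulaOver L A κ, ∀ x, ψ.val x = φ.val (x ∘ f) := by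
  refine ⟨φ.bind (n := 0) (fun a => Sum.inl (Sum.map id f a)), fun x => ?_⟩
  have h := Formula.eval_bind (n := 0) (fun a : A ⊕ ι => Sum.inl (Sum.map id f a))
    (Sum.elim (fun a : A => (a : M)) x) Fin.elim0 φ Fin.elim0
  have h0 : Fin.append (Fin.elim0 : Fin 0 → M) (Fin.elim0 : Fin 0 → M) = Fin.elim0 :=
    funext fun i => Fin.elim0 i
  rw [h0] at h
  refine h.trans ?_
  unfold FormulaOver.val
  congr 1
  funext a
  rcases a with a | i <;> rfl

theorem exists_val_iInf {ι : Type} {n : ℕ} (φ : FormulaOver L A (ι ⊕ Fin n)) :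
    ∃ ψ : FormulaOver L A ι, ∀ x, ψ.val x = ⨅ y : Fin n → M, φ.val (Sum.elim x y) := by
  let f : A ⊕ (ι ⊕ Fin n) → (A ⊕ ι) ⊕ Fin n := (Equiv.sumAssoc A ι (Fin n)).symm
  refine ⟨(φ.bind f : Formula L (A ⊕ ι) n).infAll, fun x => ?_⟩
  refine (Formula.eval_infAll _ _).trans (iInf_congr fun y => ?_)
  have h := Formula.eval_bind f (Sum.elim (fun a : A => (a : M)) x) y φ Fin.elim0
  have h0 : Fin.append y (Fin.elim0 : Fin 0 → M) = y := by
    rw [Fin.append_elim0]; rfl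
  rw [h0] at h
  refine h.trans ?_
  unfold FormulaOver.val
  congr 1
  funext a
  rcases a with a | i | j <;> rfl

end Substitution

/-! ### Truncation to the unit interval -/

/-- Truncation of a real number to the unit interval. -/
noncomputable def clip (r : ℝ) : unitInterval := Set.projIcc 0 1 zero_le_one r

theorem continuous_clip : Continuous clip := continuous_projIcc (h := zero_le_one)

theorem coe_clip (r : ℝ) : (clip r : ℝ) = max 0 (min 1 r) := by
  simp [clip, Set.coe_projIcc]

theorem coe_clip_of_nonneg {r : ℝ} (h : 0 ≤ r) : (clip r : ℝ) = min 1 r := by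
  rw [coe_clip, max_eq_right (le_min zero_le_one h)]

theorem clip_coe (t : unitInterval) : clip t = t := Set.projIcc_val _ _

theorem dist_iInf_iInf_le {J : Type*} [Nonempty J] {f g : J → unitInterval} {ε : ℝ}
    (h : ∀ j, dist (f j) (g j) ≤ ε) : dist (⨅ j, f j) (⨅ j, g j) ≤ ε := by
  have key : ∀ f g : J → unitInterval, (∀ j, dist (f j) (g j) ≤ ε) →
      ((⨅ j, f j : unitInterval) : ℝ) ≤ (⨅ j, g j : unitInterval) + ε := by
    intro f g h
    refine le_of_forall_pos_lt_add fun η hη => ?_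
    by_cases h1 : ((⨅ j, g j : unitInterval) : ℝ) + η ≤ 1
    · have h2 : (⨅ j, g j) < (⟨(⨅ j, g j : unitInterval) + η,
          add_nonneg (unitInterval.nonneg _) hη.le, h1⟩ : unitInterval) :=
        Subtype.coe_lt_coe.1 (by simpa using hη)
      obtain ⟨j, hj⟩ := iInf_lt_iff.1 h2
      have hj' : (g j : ℝ) < (⨅ j, g j : unitInterval) + η := hj
      have h3 : ((⨅ j, f j : unitInterval) : ℝ) ≤ f j := Subtype.coe_le_coe.2 (iInf_le f j)
      have h4 := h j
      rw [Subtype.dist_eq, Real.dist_eq] at h4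
      linarith [(abs_le.1 h4).2]
    · obtain ⟨j⟩ := ‹Nonempty J›
      have h4 : 0 ≤ ε := dist_nonneg.trans (h j)
      linarith [unitInterval.le_one (⨅ j, f j)]
  rw [Subtype.dist_eq, Real.dist_eq, abs_le]
  constructor
  · linarith [key g f fun j => by rw [dist_comm]; exact h j]
  · linarith [key f g h]

/-! ### Closure properties of definable predicates -/

section Definable

variable {L : Signature.{u, v}} {M : Type w} [MetricSpace M] [Structure L M]
variable {A : Set M} {ι κ : Type}

theorem IsDefinablePredicate.of_formula (φ : FormulaOver L A ι) :
    IsDefinablePredicate L A (fun x : ι → M => φ.val x) :=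
  fun _ hε => ⟨φ, fun _ => by rw [dist_self]; exact hε.le⟩

theorem IsDefinablePredicate.of_uniform_limit {P : (ι → M) → unitInterval}
    (h : ∀ ε : ℝ, 0 < ε → ∃ R : (ι → M) → unitInterval, IsDefinablePredicate L A R ∧
      ∀ x, dist (P x) (R x) ≤ ε) : IsDefinablePredicate L A P := by
  intro ε hε
  obtain ⟨R, hR, hPR⟩ := h (ε / 2) (half_pos hε)
  obtain ⟨φ, hφ⟩ := hR (ε / 2) (half_pos hε)
  exact ⟨φ, fun x => (dist_triangle _ _ _).trans (by linarith [hPR x, hφ x])⟩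

theorem IsDefinablePredicate.comp_vars {P : (ι → M) → unitInterval}
    (hP : IsDefinablePredicate L A P) (f : ι → κ) :
    IsDefinablePredicate L A (fun x : κ → M => P (x ∘ f)) := by
  intro ε hε
  obtain ⟨φ, hφ⟩ := hP ε hε
  obtain ⟨ψ, hψ⟩ := exists_val_rename f φ
  exact ⟨ψ, fun x => by rw [hψ]; exact hφ _⟩

theorem IsDefinablePredicate.conn {k : ℕ} {P : Fin k → (ι → M) → unitInterval}
    (hP : ∀ i, IsDefinablePredicate L A (P i))
    (c : C(Fin k → unitInterval, unitInterval)) :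
    IsDefinablePredicate L A (fun x => c fun i => P i x) := by
  intro ε hε
  obtain ⟨δ, hδ, hc⟩ := Metric.uniformContinuous_iff.1
    (CompactSpace.uniformContinuous_of_continuous c.continuous) ε hε
  choose φ hφ using fun i => hP i (δ / 2) (half_pos hδ)
  refine ⟨Formula.conn c φ, fun x => (hc ?_).le⟩
  refine ((dist_pi_le_iff (half_pos hδ).le).2 fun i => ?_).trans_lt (half_lt_self hδ)
  exact hφ i x

theorem IsDefinablePredicate.clip_comp {k : ℕ} {P : Fin k → (ι → M) → unitInterval}
    (hP : ∀ i, IsDefinablePredicate L A (P i)) {g : (Fin k → ℝ) → ℝ} (hg : Continuous g) :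
    IsDefinablePredicate L A (fun x => clip (g fun i => P i x)) :=
  IsDefinablePredicate.conn hP
    ⟨fun t => clip (g fun i => t i), continuous_clip.comp (hg.comp (by fun_prop))⟩

theorem IsDefinablePredicate.clip_comp₁ {P : (ι → M) → unitInterval}
    (hP : IsDefinablePredicate L A P) {g : ℝ → ℝ} (hg : Continuous g) :
    IsDefinablePredicate L A (fun x => clip (g (P x))) :=
  IsDefinablePredicate.clip_comp (k := 1) (P := fun _ => P) (fun _ => hP)
    (g := fun t => g (t 0)) (by fun_prop)

theorem IsDefinablePredicate.clip_comp₂ {P R : (ι → M) → unitInterval}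
    (hP : IsDefinablePredicate L A P) (hR : IsDefinablePredicate L A R) {g : ℝ → ℝ → ℝ}
    (hg : Continuous (Function.uncurry g)) :
    IsDefinablePredicate L A (fun x => clip (g (P x) (R x))) := by
  have hp : Continuous fun t : Fin 2 → ℝ => (t 0, t 1) := by fun_prop
  have hc : Continuous fun t : Fin 2 → ℝ => g (t 0) (t 1) := hg.comp hp
  exact IsDefinablePredicate.clip_comp (P := ![P, R]) (Fin.forall_fin_two.2 ⟨hP, hR⟩) hc

theorem IsDefinablePredicate.const (t : unitInterval) :
    IsDefinablePredicate L A (fun _ : ι → M => t) :=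
  IsDefinablePredicate.conn (k := 0) (P := fun i => i.elim0) (fun i => i.elim0)
    ⟨fun _ => t, continuous_const⟩

theorem IsDefinablePredicate.sup {P R : (ι → M) → unitInterval}
    (hP : IsDefinablePredicate L A P) (hR : IsDefinablePredicate L A R) :
    IsDefinablePredicate L A (fun x => P x ⊔ R x) := by
  have h := hP.clip_comp₂ hR (g := fun s t => max s t) (by unfold Function.uncurry; fun_prop)
  convert h using 2 with x
  rcases le_total (P x) (R x) with h | h
  · rw [sup_eq_right.2 h, max_eq_right (Subtype.coe_le_coe.2 h), clip_coe]
  · rw [sup_eq_left.2 h, max_eq_left (Subtype.coe_le_coe.2 h), clip_coe]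

theorem IsDefinablePredicate.finset_sup {J : Type*} (s : Finset J)
    {P : J → (ι → M) → unitInterval} (hP : ∀ j ∈ s, IsDefinablePredicate L A (P j)) :
    IsDefinablePredicate L A (fun x => s.sup fun j => P j x) := by
  have h : IsDefinablePredicate L A (s.sup P) :=
    Finset.sup_induction (p := IsDefinablePredicate L A)
      (IsDefinablePredicate.const ⊥) (fun _ h₁ _ h₂ => h₁.sup h₂) hP
  convert h using 2 with x
  rw [Finset.sup_apply]

theorem IsDefinablePredicate.iInf {n : ℕ} {P : (ι ⊕ Fin n → M) → unitInterval}
    (hP : IsDefinablePredicate L A P) :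
    IsDefinablePredicate L A (fun x : ι → M => ⨅ y : Fin n → M, P (Sum.elim x y)) := by
  intro ε hε
  have : Nonempty M := Structure.nonempty L
  obtain ⟨φ, hφ⟩ := hP ε hε
  obtain ⟨ψ, hψ⟩ := exists_val_iInf φ
  exact ⟨ψ, fun x => by rw [hψ]; exact dist_iInf_iInf_le fun y => hφ _⟩

theorem IsDefinablePredicate.iSup {n : ℕ} {P : (ι ⊕ Fin n → M) → unitInterval}
    (hP : IsDefinablePredicate L A P) :
    IsDefinablePredicate L A (fun x : ι → M => ⨆ y : Fin n → M, P (Sum.elim x y)) := by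
  have clip_symm : ∀ t : unitInterval, clip (1 - (t : ℝ)) = unitInterval.symm t := fun t => by
    rw [← unitInterval.coe_symm_eq, clip_coe]
  have h := (hP.clip_comp₁ (g := fun t => 1 - t) (by fun_prop)).iInf.clip_comp₁
    (g := fun t => 1 - t) (by fun_prop)
  simp only [clip_symm] at h
  convert h using 2 with x
  apply le_antisymm
  · exact iSup_le fun y => unitInterval.le_symm_comm.1 (iInf_le _ y)
  · exact unitInterval.symm_le_comm.1 (le_iInf fun y =>
      unitInterval.symm_le_symm.2 (le_iSup (fun y => P (Sum.elim x y)) y))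

theorem IsDefinablePredicate.dist_vars (i j : ι) :
    IsDefinablePredicate L A (fun x : ι → M => clip (dist (x i) (x j))) := by
  have h := IsDefinablePredicate.of_formula (L := L) (A := A)
    (Formula.metric (.var (.inl (.inr i))) (.var (.inl (.inr j))) : FormulaOver L A ι)
  convert h using 2 with x
  exact Set.projIcc_of_mem _ ⟨dist_nonneg, Structure.dist_le_one L _ _⟩

end Definable

theorem exists_lt_iInf_add {J : Type*} [Nonempty J] (f : J → unitInterval) {η : ℝ} (hη : 0 < η) :
    ∃ j, (f j : ℝ) < (⨅ j, f j : unitInterval) + η := by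
  by_contra! h
  have h0 : ((⨅ j, f j : unitInterval) : ℝ) + η ≤ 1 :=
    (h (Classical.arbitrary J)).trans (unitInterval.le_one _)
  have h2 : (⟨(⨅ j, f j : unitInterval) + η,
      add_nonneg (unitInterval.nonneg _) hη.le, h0⟩ : unitInterval) ≤ ⨅ j, f j :=
    le_iInf fun j => Subtype.coe_le_coe.1 (h j)
  have h3 : ((⨅ j, f j : unitInterval) : ℝ) + η ≤ (⨅ j, f j : unitInterval) := h2
  linarith

/-! ### Chains for an almost pseudo-metric -/

section Chain

variable {Y : Type*}

/-- The infimum, truncated at `1`, of the `Q`-lengths of all chains of `m + 1` steps. -/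
noncomputable def chainInf (Q : Y → Y → unitInterval) : ℕ → Y → Y → unitInterval
  | 0 => Q
  | m + 1 => fun x z => ⨅ y, clip (chainInf Q m x y + Q y z)

/-- A symmetric function, zero on the diagonal, whose defect in the triangle inequality is at most
quadratic. -/
structure IsAlmostPseudoMetric (Q : Y → Y → unitInterval) : Prop where
  self : ∀ x, Q x x = 0
  comm : ∀ x y, Q x y = Q y x
  triangle : ∀ x y z, (Q x z : ℝ) ≤ Q x y + Q y z + max (Q x y : ℝ) (Q y z) ^ 2

variable {Q : Y → Y → unitInterval}

theorem chainInf_succ_le (m : ℕ) (x y z : Y) :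
    (chainInf Q (m + 1) x z : ℝ) ≤ chainInf Q m x y + Q y z := by
  have h : chainInf Q (m + 1) x z ≤ clip (chainInf Q m x y + Q y z) := iInf_le _ y
  refine (Subtype.coe_le_coe.2 h).trans ?_
  rw [coe_clip_of_nonneg (add_nonneg (unitInterval.nonneg _) (unitInterval.nonneg _))]
  exact min_le_right _ _

theorem exists_chainInf_add_lt (m : ℕ) {x z : Y} {r : ℝ}
    (h : (chainInf Q (m + 1) x z : ℝ) < r) (hr : r ≤ 1) :
    ∃ y, (chainInf Q m x y : ℝ) + Q y z < r := by
  have : Nonempty Y := ⟨x⟩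
  obtain ⟨y, hy⟩ := exists_lt_iInf_add (fun y => clip (chainInf Q m x y + Q y z)) (sub_pos.2 h)
  refine ⟨y, ?_⟩
  have h' : (clip (chainInf Q m x y + Q y z) : ℝ) < r := by
    have : ((⨅ y, clip (chainInf Q m x y + Q y z) : unitInterval) : ℝ)
      = chainInf Q (m + 1) x z := rfl
    linarith
  rw [coe_clip_of_nonneg (add_nonneg (unitInterval.nonneg _) (unitInterval.nonneg _))] at h'
  rcases min_lt_iff.1 h' with h' | h'
  · linarith
  · exact h'

theorem le_chainInf_succ {m : ℕ} {x z : Y} {r : ℝ} (hr : r ≤ 1)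
    (h : ∀ y, r ≤ (chainInf Q m x y : ℝ) + Q y z) : r ≤ chainInf Q (m + 1) x z := by
  by_contra! hlt
  obtain ⟨y, hy⟩ := exists_chainInf_add_lt m hlt hr
  linarith [h y]

theorem IsAlmostPseudoMetric.chainInf_self (hQ : IsAlmostPseudoMetric Q)
    (m : ℕ) (x : Y) : chainInf Q m x x = 0 := by
  induction m with
  | zero => exact hQ.self x
  | succ m ih =>
    have h := chainInf_succ_le (Q := Q) m x x x
    rw [ih, hQ.self] at h
    exact le_antisymm (Subtype.coe_le_coe.1 (by simpa using h)) (unitInterval.nonneg' )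

theorem IsAlmostPseudoMetric.chainInf_antitone (hQ : IsAlmostPseudoMetric Q) (x z : Y) :
    Antitone fun m => chainInf Q m x z := by
  refine antitone_nat_of_succ_le fun m => Subtype.coe_le_coe.1 ?_
  have h := chainInf_succ_le (Q := Q) m x z z
  rwa [hQ.self, Set.Icc.coe_zero, add_zero] at h

/-- Concatenation: `a + 1` steps and `b + 1` steps make `a + b + 2` steps, which is index `a + b +
1`. -/
theorem chainInf_triangle (a b : ℕ) (x y z : Y) :
    (chainInf Q (a + b + 1) x z : ℝ) ≤ chainInf Q a x y + chainInf Q b y z := by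
  induction b generalizing z with
  | zero => exact chainInf_succ_le a x y z
  | succ b ih =>
    -- Because of the truncation, `le_chainInf_succ` only accepts lower bounds that are at most `1`.
    by_cases h1 : (chainInf Q (a + (b + 1) + 1) x z : ℝ) - chainInf Q a x y ≤ 1
    · rw [← sub_le_iff_le_add']
      refine le_chainInf_succ h1 fun w => ?_
      have h : (chainInf Q (a + (b + 1) + 1) x z : ℝ) ≤ chainInf Q (a + b + 1) x w + Q w z :=
        chainInf_succ_le _ _ _ _
      linarith [ih w]
    · linarith [unitInterval.le_one (chainInf Q (a + (b + 1) + 1) x z),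
        unitInterval.nonneg (chainInf Q a x y)]

/-- The recursion appends steps at the end; reversing a chain needs them at the front, which
concatenation with a single step allows. -/
theorem IsAlmostPseudoMetric.chainInf_comm (hQ : IsAlmostPseudoMetric Q) (m : ℕ) (x z : Y) :
    chainInf Q m x z = chainInf Q m z x := by
  have key : ∀ x z, (chainInf Q m z x : ℝ) ≤ chainInf Q m x z := by
    induction m with
    | zero => exact fun x z => by simp only [chainInf, hQ.comm x z]; exact le_rfl
    | succ m ih =>
      intro x z
      refine le_chainInf_succ (unitInterval.le_one _) fun y => ?_
      have h := chainInf_triangle (Q := Q) 0 m z y x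
      rw [zero_add] at h
      have h' : (chainInf Q 0 z y : ℝ) = Q y z := by simp only [chainInf, hQ.comm z y]
      linarith [ih x y]
  exact le_antisymm (Subtype.coe_le_coe.1 (key z x)) (Subtype.coe_le_coe.1 (key x z))

/-- Two consecutive steps that are shorter than `t` can be replaced by one, at the cost of `t ^ 2`;
so a chain that cannot be shortened in this manner is long. -/
theorem IsAlmostPseudoMetric.min_le_chainInf_succ (hQ : IsAlmostPseudoMetric Q)
    {t : ℝ} (ht : 0 ≤ t) (m : ℕ) (x z : Y) :
    min 1 (min (t * (m + 1) / 2) (chainInf Q m x z - t ^ 2)) ≤ chainInf Q (m + 1) x z := by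
  have sq : ∀ q r : unitInterval, (q : ℝ) ≤ t → (r : ℝ) ≤ t → max (q : ℝ) r ^ 2 ≤ t ^ 2 :=
    fun q r h₁ h₂ => pow_le_pow_left₀ (le_max_of_le_left (unitInterval.nonneg q)) (max_le h₁ h₂) 2
  -- Among `m + 2` steps there are at least `(m + 1) / 2` disjoint consecutive pairs, and a pair
  -- that cannot be merged is longer than `t`. The induction removes the last pair, hence goes down
  -- by two.
  induction m using Nat.twoStepInduction generalizing z with
  | zero =>
    refine le_chainInf_succ (min_le_left _ _) fun y => ?_
    change _ ≤ (Q x y : ℝ) + Q y z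
    have hxy := unitInterval.nonneg (Q x y)
    have hyz := unitInterval.nonneg (Q y z)
    by_cases h : (Q x y : ℝ) ≤ t ∧ (Q y z : ℝ) ≤ t
    · refine (min_le_right _ _).trans ((min_le_right _ _).trans ?_)
      change (Q x z : ℝ) - t ^ 2 ≤ _
      linarith [hQ.triangle x y z, sq _ _ h.1 h.2]
    · refine (min_le_right _ _).trans ((min_le_left _ _).trans ?_)
      rw [not_and_or, not_le, not_le] at h
      push_cast
      rcases h with h | h <;> linarith
  | one =>
    refine le_chainInf_succ (min_le_left _ _) fun w => ?_
    by_contra! hlt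
    have h1 : (chainInf Q 1 x w : ℝ) < min 1 (min (t * ((1 : ℕ) + 1) / 2)
        (chainInf Q 1 x z - t ^ 2)) - Q w z := by linarith
    obtain ⟨y, hy⟩ := exists_chainInf_add_lt 0 h1
      (by linarith [min_le_left (1 : ℝ) (min (t * ((1 : ℕ) + 1) / 2) (chainInf Q 1 x z - t ^ 2)),
        unitInterval.nonneg (Q w z)])
    change (Q x y : ℝ) + _ < _ at hy
    have hxy := unitInterval.nonneg (Q x y)
    have hyw := unitInterval.nonneg (Q y w)
    have hwz := unitInterval.nonneg (Q w z)
    have m1 := (min_le_right (1 : ℝ) (min (t * ((1 : ℕ) + 1) / 2) (chainInf Q 1 x z - t ^ 2)))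
    have m2 := m1.trans (min_le_left _ _)
    have m3 := m1.trans (min_le_right _ _)
    push_cast at m2
    by_cases h : (Q x y : ℝ) ≤ t ∧ (Q y w : ℝ) ≤ t
    · have h2 := chainInf_succ_le (Q := Q) 0 x w z
      change _ ≤ (Q x w : ℝ) + _ at h2
      rw [zero_add] at h2
      linarith [hQ.triangle x y w, sq _ _ h.1 h.2]
    · rw [not_and_or, not_le, not_le] at h
      rcases h with h | h <;> linarith
  | more m ih _ =>
    refine le_chainInf_succ (min_le_left _ _) fun w => ?_
    by_contra! hlt
    set r := min 1 (min (t * (((m + 2 : ℕ) : ℝ) + 1) / 2)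
      ((chainInf Q (m + 2) x z : ℝ) - t ^ 2)) with hr
    have m1 : r ≤ 1 := min_le_left _ _
    have m2 : r ≤ t * (((m + 2 : ℕ) : ℝ) + 1) / 2 := (min_le_right _ _).trans (min_le_left _ _)
    have m3 : r ≤ (chainInf Q (m + 2) x z : ℝ) - t ^ 2 :=
      (min_le_right _ _).trans (min_le_right _ _)
    have hwz := unitInterval.nonneg (Q w z)
    have h1 : (chainInf Q (m + 1 + 1) x w : ℝ) < r - Q w z := by linarith
    obtain ⟨y, hy⟩ := exists_chainInf_add_lt (m + 1) h1 (by linarith)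
    have hyw := unitInterval.nonneg (Q y w)
    have hxy := unitInterval.nonneg (chainInf Q (m + 1) x y)
    have hshort := chainInf_succ_le (Q := Q) (m + 1) x y z
    by_cases h : (Q y w : ℝ) ≤ t ∧ (Q w z : ℝ) ≤ t
    · linarith [hQ.triangle y w z, sq _ _ h.1 h.2]
    · have hlong : t < (Q y w : ℝ) + Q w z := by
        rw [not_and_or, not_le, not_le] at h
        rcases h with h | h <;> linarith
      have e : t * (((m + 2 : ℕ) : ℝ) + 1) / 2 = t * ((m : ℝ) + 1) / 2 + t := by
        push_cast; ring
      rcases min_le_iff.1 (ih y) with h | h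
      · linarith
      · rcases min_le_iff.1 h with h | h
        · linarith
        -- The part of the chain up to `y` can be shortened; the last two steps are put back.
        · have h2 := chainInf_succ_le (Q := Q) m x y w
          have h3 := chainInf_succ_le (Q := Q) (m + 1) x w z
          linarith

/-- The choice `t = 2 * s / (m + 1)` turns the bound for unmergeable chains into `s`, which is
excluded; so a merge must be possible. -/
theorem IsAlmostPseudoMetric.chainInf_le_succ_add (hQ : IsAlmostPseudoMetric Q)
    (m : ℕ) (x z : Y) {s : ℝ} (hs0 : 0 ≤ s)
    (hs : s ≤ 1) (h : (chainInf Q (m + 1) x z : ℝ) < s) :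
    (chainInf Q m x z : ℝ) ≤ chainInf Q (m + 1) x z + (2 * s / (m + 1)) ^ 2 := by
  have hm : (0 : ℝ) < m + 1 := by positivity
  have h1 := hQ.min_le_chainInf_succ (t := 2 * s / (m + 1)) (by positivity) m x z
  have e : 2 * s / ((m : ℝ) + 1) * (m + 1) / 2 = s := by field_simp
  rw [e] at h1
  rcases min_le_iff.1 h1 with h1 | h1
  · linarith
  · rcases min_le_iff.1 h1 with h1 | h1 <;> linarith

theorem inv_sq_le_telescope (m : ℕ) :
    (2 / ((m : ℝ) + 1)) ^ 2 ≤ 8 / ((m : ℝ) + 1) - 8 / (((m + 1 : ℕ) : ℝ) + 1) := by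
  have hm : (0 : ℝ) ≤ m := m.cast_nonneg
  push_cast
  rw [div_sub_div _ _ (by positivity) (by positivity), div_pow,
    div_le_div_iff₀ (by positivity) (by positivity)]
  nlinarith [mul_nonneg hm hm, mul_nonneg (mul_nonneg hm hm) hm]

/-- The pseudo-metric generated by `Q`. -/
noncomputable def chainDist {Y : Type*} (Q : Y → Y → unitInterval) (x z : Y) : unitInterval :=
  ⨅ m, chainInf Q m x z

theorem chainDist_le (m : ℕ) (x z : Y) : (chainDist Q x z : ℝ) ≤ chainInf Q m x z :=
  Subtype.coe_le_coe.2 (iInf_le _ m)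

theorem IsAlmostPseudoMetric.chainInf_le_chainDist_add (hQ : IsAlmostPseudoMetric Q)
    (m : ℕ) (x z : Y) :
    (chainInf Q m x z : ℝ) ≤ chainDist Q x z + 8 / (m + 1) := by
  have step : ∀ k : ℕ, (chainInf Q k x z : ℝ) ≤ chainInf Q (k + 1) x z
      + (2 / ((k : ℝ) + 1)) ^ 2 := by
    intro k
    rcases (unitInterval.le_one (chainInf Q (k + 1) x z)).lt_or_eq with h | h
    · simpa using hQ.chainInf_le_succ_add k x z zero_le_one le_rfl h
    · rw [h]
      have : (0 : ℝ) ≤ (2 / ((k : ℝ) + 1)) ^ 2 := by positivity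
      linarith [unitInterval.le_one (chainInf Q k x z)]
  -- The merging costs from index `m` on telescope to at most `8 / (m + 1)`.
  have mono : Monotone fun k : ℕ => (chainInf Q k x z : ℝ) - 8 / ((k : ℝ) + 1) :=
    monotone_nat_of_le_succ fun k => by linarith [step k, inv_sq_le_telescope k]
  refine le_of_forall_pos_le_add fun η hη => ?_
  obtain ⟨k, hk⟩ := exists_lt_iInf_add (fun k => chainInf Q k x z) hη
  have h1 := mono (le_max_left m k)
  have h2 : (chainInf Q (max m k) x z : ℝ) ≤ chainInf Q k x z :=
    hQ.chainInf_antitone x z (le_max_right m k)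
  have h3 : (0 : ℝ) ≤ 8 / (((max m k : ℕ) : ℝ) + 1) := by positivity
  change (chainInf Q k x z : ℝ) < chainDist Q x z + η at hk
  simp only at h1
  linarith

theorem IsAlmostPseudoMetric.isPseudoMetric_chainDist (hQ : IsAlmostPseudoMetric Q)
    : IsPseudoMetric (chainDist Q) where
  self x := by simp only [chainDist, hQ.chainInf_self, iInf_const]
  comm x z := by simp only [chainDist, hQ.chainInf_comm]
  triangle x y z := by
    refine le_of_forall_pos_le_add fun η hη => ?_
    obtain ⟨a, ha⟩ := exists_lt_iInf_add (fun k => chainInf Q k x y) (half_pos hη)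
    obtain ⟨b, hb⟩ := exists_lt_iInf_add (fun k => chainInf Q k y z) (half_pos hη)
    change _ < (chainDist Q x y : ℝ) + η / 2 at ha
    change _ < (chainDist Q y z : ℝ) + η / 2 at hb
    linarith [chainInf_triangle (Q := Q) a b x y z, chainDist_le (Q := Q) (a + b + 1) x z]

/-- The uniform rate says nothing about a single step. But for chains of length below `s` every
merging cost carries a factor `s ^ 2`, so merging down to one step costs at most `8 * s ^ 2` in all.
-/
theorem IsAlmostPseudoMetric.eq_zero_of_chainDist_eq_zero (hQ : IsAlmostPseudoMetric Q) {x z : Y}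
    (h : chainDist Q x z = 0) : Q x z = 0 := by
  have bound : ∀ s : ℝ, 0 < s → s ≤ 1 / 16 → (Q x z : ℝ) ≤ s := by
    intro s hs hs'
    -- Descent from index `m` to `0`: the term added to `a` is the total cost still to be paid, and
    -- keeping the sum below `s` permits every merge on the way.
    have key : ∀ (m : ℕ) (a : ℝ), a + 8 * s ^ 2 - 8 * s ^ 2 / ((m : ℝ) + 1) < s →
        (chainInf Q m x z : ℝ) ≤ a →
        (Q x z : ℝ) ≤ a + 8 * s ^ 2 - 8 * s ^ 2 / ((m : ℝ) + 1) := by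
      intro m
      induction m with
      | zero =>
        intro a _ ha
        have : (Q x z : ℝ) ≤ a := ha
        simpa using this
      | succ m ih =>
        intro a ha hle
        have tel := mul_le_mul_of_nonneg_left (inv_sq_le_telescope m) (sq_nonneg s)
        have e1 : s ^ 2 * (2 / ((m : ℝ) + 1)) ^ 2 = (2 * s / (m + 1)) ^ 2 := by ring
        have e2 : s ^ 2 * (8 / ((m : ℝ) + 1) - 8 / (((m + 1 : ℕ) : ℝ) + 1)) =
          8 * s ^ 2 / ((m : ℝ) + 1) - 8 * s ^ 2 / (((m + 1 : ℕ) : ℝ) + 1) := by ring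
        have hfrac : 8 * s ^ 2 / (((m + 1 : ℕ) : ℝ) + 1) ≤ 8 * s ^ 2 :=
          div_le_self (by positivity) (by linarith [(m + 1).cast_nonneg (α := ℝ)])
        rw [e1, e2] at tel
        have h1 := hQ.chainInf_le_succ_add m x z hs.le (by linarith) (by linarith)
        have h2 := ih (a + (2 * s / (m + 1)) ^ 2) (by linarith) (by linarith)
        linarith
    obtain ⟨m, hm⟩ := exists_lt_iInf_add (fun k => chainInf Q k x z) (half_pos hs)
    change _ < (chainDist Q x z : ℝ) + s / 2 at hm
    rw [h, Set.Icc.coe_zero, zero_add] at hm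
    -- This is where `s ≤ 1 / 16` enters: a chain of length `s / 2` leaves `s / 2` for the merging.
    have hsq : 8 * s ^ 2 ≤ s / 2 := by nlinarith
    have hfrac : 0 < 8 * s ^ 2 / ((m : ℝ) + 1) := by positivity
    linarith [key m (s / 2) (by linarith) hm.le]
  refine le_antisymm (Subtype.coe_le_coe.1 ?_) unitInterval.nonneg'
  refine le_of_forall_pos_le_add fun η hη => ?_
  rw [Set.Icc.coe_zero, zero_add]
  exact (bound (min η (1 / 16)) (lt_min hη (by norm_num)) (min_le_right _ _)).trans
    (min_le_left _ _)

/-- A function that is `1`-Lipschitz for `Q` is `1`-Lipschitz for the generated pseudo-metric. -/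
theorem le_add_chainDist {f : Y → unitInterval} (hf : ∀ y z, (f z : ℝ) ≤ f y + Q y z) (y z : Y) :
    (f z : ℝ) ≤ f y + chainDist Q y z := by
  have h : ∀ (m : ℕ) (z : Y), (f z : ℝ) ≤ f y + chainInf Q m y z := by
    intro m
    induction m with
    | zero => exact fun z => hf y z
    | succ m ih =>
      intro z
      rw [← sub_le_iff_le_add']
      refine le_chainInf_succ
        (by linarith [unitInterval.le_one (f z), unitInterval.nonneg (f y)]) fun w => ?_
      linarith [ih w, hf w z]
  refine le_of_forall_pos_le_add fun η hη => ?_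
  have : Nonempty ℕ := ⟨0⟩
  obtain ⟨m, hm⟩ := exists_lt_iInf_add (fun k => chainInf Q k y z) hη
  change _ < (chainDist Q y z : ℝ) + η at hm
  linarith [h m z]

end Chain

/-! ### Saturation and compactness -/

section Compactness

variable {L : Signature.{u, v}} {M : Type w} [MetricSpace M] [Structure L M]
variable {A : Set M}

/-- Saturation speaks of formulas only. If `ψ` is within `η / 3` of `P`, then `ψ` truncated by `2 *
η / 3` vanishes wherever `P ≤ η / 3`, and its vanishing at `x` gives `P x ≤ η`. -/
theorem IsDefinablePredicate.eq_zero_of_forall_formula {ι : Type} {P : (ι → M) → unitInterval}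
    (hP : IsDefinablePredicate L A P) {x : ι → M}
    (h : ∀ φ : FormulaOver L A ι, (∃ δ : ℝ, 0 < δ ∧ ∀ y, (P y : ℝ) ≤ δ → φ.val y = 0) →
      φ.val x = 0) : P x = 0 := by
  refine le_antisymm (Subtype.coe_le_coe.1 ?_) unitInterval.nonneg'
  rw [Set.Icc.coe_zero]
  refine le_of_forall_pos_le_add fun η hη => ?_
  obtain ⟨ψ, hψ⟩ := hP (η / 3) (by positivity)
  have abs_le' := fun y => abs_le.1 ((Subtype.dist_eq _ _).symm.trans_le (hψ y))
  let c : C(Fin 1 → unitInterval, unitInterval) :=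
    ⟨fun t => clip (t 0 - 2 * η / 3), continuous_clip.comp (by fun_prop)⟩
  have hval : ∀ y, FormulaOver.val (Formula.conn c fun _ => ψ : FormulaOver L A ι) y
      = clip (ψ.val y - 2 * η / 3) := fun _ => rfl
  have h0 := h (Formula.conn c fun _ => ψ) ⟨η / 3, by positivity, fun y hy => by
    rw [hval]
    exact Set.projIcc_of_le_left _ (by linarith [(abs_le' y).1])⟩
  rw [hval] at h0
  have h1 := congrArg Subtype.val h0
  rw [coe_clip, Set.Icc.coe_zero] at h1
  have h2 : min 1 ((ψ.val x : ℝ) - 2 * η / 3) ≤ 0 := (le_max_right _ _).trans_eq h1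
  have h3 : (ψ.val x : ℝ) - 2 * η / 3 ≤ 0 :=
    (min_le_iff.1 h2).resolve_left (by norm_num)
  linarith [(abs_le' x).2]

/-- In a saturated structure, an implication between conditions holds uniformly. -/
theorem IsSaturated.exists_finset_le
    (hM : IsSaturated L M (Order.succ (max (Cardinal.mk A) Cardinal.aleph0)))
    {ι : Type} [Finite ι] {J : Type*} {g : J → (ι → M) → unitInterval}
    {H G : (ι → M) → unitInterval} (hg : ∀ j, IsDefinablePredicate L A (g j))
    (hH : IsDefinablePredicate L A H) (hG : IsDefinablePredicate L A G)
    (h : ∀ x, (∀ j, g j x = 0) → H x = 0 → G x = 0) {ε : ℝ} (hε : 0 < ε) :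
    ∃ (F : Finset J) (δ : ℝ), 0 < δ ∧
      ∀ x, (∀ j ∈ F, (g j x : ℝ) ≤ δ) → H x = 0 → (G x : ℝ) ≤ ε := by
  classical
  by_contra! hcon
  obtain ⟨m, ⟨e⟩⟩ := Finite.exists_equiv_fin ι
  -- Finitely many of these formulas vanish exactly at one counterexample, taken for suitable `F'`
  -- and `δ`. A common zero has all `g j = 0`, `H = 0` and `G ≥ ε`, against the implication.
  let Γ : Set (FormulaOver L A (Fin m)) := {φ |
    (∃ j, ∃ δ : ℝ, 0 < δ ∧ ∀ y : Fin m → M, (g j (y ∘ e) : ℝ) ≤ δ → φ.val y = 0) ∨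
    ∀ y : Fin m → M, H (y ∘ e) = 0 → ε < G (y ∘ e) → φ.val y = 0}
  have hfin : ∀ F : Finset (FormulaOver L A (Fin m)), (F : Set _) ⊆ Γ →
      ∃ (F' : Finset J) (δ : ℝ), 0 < δ ∧ ∀ y : Fin m → M,
        (∀ j ∈ F', (g j (y ∘ e) : ℝ) ≤ δ) → H (y ∘ e) = 0 → ε < G (y ∘ e) →
        ∀ φ ∈ F, φ.val y = 0 := by
    intro F
    induction F using Finset.induction_on with
    | empty => exact fun _ => ⟨∅, 1, one_pos, fun y _ _ _ φ hφ => by simp at hφ⟩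
    | insert φ F _ ih =>
      intro hF
      rw [Finset.coe_insert, Set.insert_subset_iff] at hF
      obtain ⟨F', δ, hδ, hF'⟩ := ih hF.2
      rcases hF.1 with ⟨j, δ', hδ', hj⟩ | hφ
      · refine ⟨insert j F', min δ δ', lt_min hδ hδ', fun y hy hHy hGy => ?_⟩
        rw [Finset.forall_mem_insert] at hy ⊢
        exact ⟨hj y (hy.1.trans (min_le_right _ _)),
          hF' y (fun i hi => (hy.2 i hi).trans (min_le_left _ _)) hHy hGy⟩
      · refine ⟨F', δ, hδ, fun y hy hHy hGy => ?_⟩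
        rw [Finset.forall_mem_insert]
        exact ⟨hφ y hHy hGy, hF' y hy hHy hGy⟩
  have hcard : Cardinal.mk A < Order.succ (max (Cardinal.mk A) Cardinal.aleph0) :=
    Order.lt_succ_of_le (le_max_left _ _)
  obtain ⟨x, hx⟩ := hM A hcard m Γ fun F hF η hη => by
    obtain ⟨F', δ, hδ, hF'⟩ := hfin F hF
    obtain ⟨z, hz, hHz, hGz⟩ := hcon F' δ hδ
    have hze : (z ∘ e.symm) ∘ e = z := by funext i; simp
    refine ⟨z ∘ e.symm, fun φ hφ => ?_⟩
    rw [hF' (z ∘ e.symm) (by rwa [hze]) (by rwa [hze]) (by rwa [hze]) φ hφ]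
    exact hη.le
  have hgx : ∀ j, g j (x ∘ e) = 0 := fun j =>
    ((hg j).comp_vars e).eq_zero_of_forall_formula fun φ ⟨δ, hδ, hφ⟩ =>
      hx φ (Or.inl ⟨j, δ, hδ, hφ⟩)
  have hHx : H (x ∘ e) = 0 :=
    (hH.comp_vars e).eq_zero_of_forall_formula fun φ ⟨δ, hδ, hφ⟩ =>
      hx φ (Or.inr fun y hy _ => hφ y (by rw [hy]; exact hδ.le))
  have hGx := ((hG.comp_vars e).clip_comp₁ (g := fun t => ε - t)
    (by fun_prop)).eq_zero_of_forall_formula (x := x) fun φ ⟨δ, hδ, hφ⟩ =>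
      hx φ (Or.inr fun y _ hy => hφ y (by
        rw [coe_clip]
        exact max_le hδ.le ((min_le_right _ _).trans (by linarith))))
  rw [h _ hgx hHx, Set.Icc.coe_zero, sub_zero] at hGx
  have h1 := congrArg Subtype.val hGx
  rw [coe_clip_of_nonneg hε.le, Set.Icc.coe_zero] at h1
  exact (lt_min one_pos hε).ne' h1

variable {n : ℕ}

/-- The form of `IsSaturated.exists_finset_le` for triples from a type-definable set. -/
theorem IsSaturated.exists_finset_le_triple
    (hM : IsSaturated L M (Order.succ (max (Cardinal.mk A) Cardinal.aleph0)))
    (Γ : Set (FormulaOver L A (Fin n)))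
    {H G : (Fin 3 × Fin n → M) → unitInterval}
    (hH : IsDefinablePredicate L A H) (hG : IsDefinablePredicate L A G)
    (h : ∀ x, (∀ i, ∀ φ ∈ Γ, φ.val (fun l => x (i, l)) = 0) → H x = 0 → G x = 0)
    {ε : ℝ} (hε : 0 < ε) :
    ∃ (F : Finset Γ) (δ : ℝ), 0 < δ ∧ ∀ x,
      (∀ i, ∀ φ ∈ F, (φ.1.val (fun l => x (i, l)) : ℝ) ≤ δ) → H x = 0 → (G x : ℝ) ≤ ε := by
  classical
  obtain ⟨F, δ, hδ, hF⟩ := hM.exists_finset_le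
    (g := fun (j : Γ × Fin 3) (x : Fin 3 × Fin n → M) => j.1.1.val (fun l => x (j.2, l)))
    (fun j => (IsDefinablePredicate.of_formula j.1.1).comp_vars fun l => (j.2, l)) hH hG
    (fun x hx => h x fun i φ hφ => hx (⟨φ, hφ⟩, i)) hε
  exact ⟨F.image Prod.fst, δ, hδ, fun x hx =>
    hF x fun j hj => hx j.2 j.1 (Finset.mem_image_of_mem _ hj)⟩

/-- Countably many neighbourhoods of a type-definable set contain the sublevel sets of a single
definable predicate that vanishes on that set. -/
theorem exists_definable_sublevel_subset (Γ : Set (FormulaOver L A (Fin n)))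
    (F : ℕ → Finset Γ) (δ : ℕ → ℝ) (hδ : ∀ k, 0 < δ k) :
    ∃ θ : (Fin n → M) → unitInterval, IsDefinablePredicate L A θ ∧
      (∀ x, (∀ φ ∈ Γ, φ.val x = 0) → θ x = 0) ∧
      ∀ k x, (θ x : ℝ) < (1 / 2) ^ k → ∀ φ ∈ F k, (φ.1.val x : ℝ) ≤ δ k := by
  -- If some `φ ∈ F k` exceeds `δ k`, then `ψ k` reaches the cap `(1 / 2) ^ k`, hence so does the
  -- supremum. The caps make the supremum a uniform limit of finite ones.
  let ψ : ℕ → (Fin n → M) → unitInterval := fun k x =>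
    clip ((1 / 2) ^ k * (((F k).sup fun φ => φ.1.val x : unitInterval) / δ k))
  have hψ : ∀ k, IsDefinablePredicate L A (ψ k) := fun k =>
    (IsDefinablePredicate.finset_sup (F k) fun φ _ =>
      IsDefinablePredicate.of_formula φ.1).clip_comp₁
        (g := fun t => (1 / 2) ^ k * (t / δ k)) (by fun_prop)
  let τ : ℕ → (Fin n → M) → unitInterval := fun k x => ψ k x ⊓ clip ((1 / 2) ^ k)
  have hτ : ∀ k, IsDefinablePredicate L A (τ k) := by
    intro k
    have h := (hψ k).clip_comp₁ (g := fun t => min t ((1 / 2) ^ k)) (by fun_prop)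
    have hk : (clip ((1 / 2) ^ k) : ℝ) = (1 / 2) ^ k := by
      rw [coe_clip_of_nonneg (by positivity)]
      exact min_eq_right (pow_le_one₀ (by norm_num) (by norm_num))
    convert h using 2 with x
    rw [← clip_coe (τ k x), ← hk]
    rfl
  have hτle : ∀ k x, (τ k x : ℝ) ≤ (1 / 2) ^ k := fun k x => by
    have h : (τ k x : ℝ) ≤ clip ((1 / 2) ^ k) := Subtype.coe_le_coe.2 inf_le_right
    refine h.trans ?_
    rw [coe_clip_of_nonneg (by positivity)]
    exact min_le_right _ _
  refine ⟨fun x => ⨆ k, τ k x, ?_, fun x hx => ?_, fun k x hk φ hφ => ?_⟩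
  · refine IsDefinablePredicate.of_uniform_limit fun ε hε => ?_
    obtain ⟨N, hN⟩ := exists_pow_lt_of_lt_one hε (by norm_num : (1 / 2 : ℝ) < 1)
    refine ⟨_, IsDefinablePredicate.finset_sup (Finset.range N) fun k _ => hτ k, fun x => ?_⟩
    have h1 : ((Finset.range N).sup fun k => τ k x) ≤ ⨆ k, τ k x :=
      Finset.sup_le fun k _ => le_iSup (fun k => τ k x) k
    have h2 : (⨆ k, τ k x) ≤ clip (((Finset.range N).sup fun k => τ k x : unitInterval) + ε) := by
      refine iSup_le fun k => Subtype.coe_le_coe.1 ?_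
      rw [coe_clip_of_nonneg (add_nonneg (unitInterval.nonneg _) hε.le)]
      refine le_min (unitInterval.le_one _) ?_
      by_cases hkN : k < N
      · have h3 : τ k x ≤ (Finset.range N).sup fun k => τ k x :=
          Finset.le_sup (f := fun k => τ k x) (Finset.mem_range.2 hkN)
        have h4 : (τ k x : ℝ) ≤ ((Finset.range N).sup fun k => τ k x : unitInterval) := h3
        linarith
      · have h3 := pow_le_pow_of_le_one (by norm_num : (0 : ℝ) ≤ 1 / 2) (by norm_num)
          (not_lt.1 hkN)
        linarith [hτle k x,
          unitInterval.nonneg ((Finset.range N).sup fun k => τ k x)]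
    have h3 : ((⨆ k, τ k x : unitInterval) : ℝ) ≤
        ((Finset.range N).sup fun k => τ k x : unitInterval) + ε := by
      refine (Subtype.coe_le_coe.2 h2).trans ?_
      rw [coe_clip_of_nonneg (add_nonneg (unitInterval.nonneg _) hε.le)]
      exact min_le_right _ _
    have h4 : (((Finset.range N).sup fun k => τ k x : unitInterval) : ℝ) ≤
      (⨆ k, τ k x : unitInterval) := h1
    rw [Subtype.dist_eq, Real.dist_eq, abs_le]
    constructor <;> linarith
  · have hzero : ∀ k, τ k x = 0 := by
      intro k
      have h1 : ((F k).sup fun φ => φ.1.val x) = 0 :=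
        le_antisymm (Finset.sup_le fun φ _ => (hx φ.1 φ.2).le) unitInterval.nonneg'
      have h2 : ψ k x = 0 := by
        change clip _ = 0
        rw [h1, Set.Icc.coe_zero, zero_div, mul_zero]
        exact clip_coe 0
      refine le_antisymm ?_ unitInterval.nonneg'
      exact inf_le_left.trans h2.le
    simp only [hzero, iSup_const]
  · by_contra! hlt
    have hlt1 : (1 : ℝ) ≤ ((F k).sup fun φ => φ.1.val x : unitInterval) / δ k := by
      rw [le_div_iff₀ (hδ k), one_mul]
      exact hlt.le.trans (Subtype.coe_le_coe.2 (Finset.le_sup (f := fun φ => φ.1.val x) hφ))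
    have hle1 : ((1 : ℝ) / 2) ^ k ≤ 1 := pow_le_one₀ (by norm_num) (by norm_num)
    have hpos : (0 : ℝ) < (1 / 2) ^ k := by positivity
    have h1 : clip ((1 / 2) ^ k) ≤ τ k x := by
      refine le_inf (Set.monotone_projIcc zero_le_one ?_) le_rfl
      exact le_mul_of_one_le_right hpos.le hlt1
    have h2 : (clip ((1 / 2) ^ k) : ℝ) ≤ (⨆ k, τ k x : unitInterval) :=
      Subtype.coe_le_coe.2 (h1.trans (le_iSup (fun k => τ k x) k))
    rw [coe_clip_of_nonneg hpos.le, min_eq_right hle1] at h2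
    linarith

end Compactness

/-! ### Definable neighbourhoods of a type-definable set -/

section Neighbourhood

variable {L : Signature.{u, v}} {M : Type w} [MetricSpace M] [Structure L M]
variable {A : Set M} {n : ℕ}

theorem IsDefinableBinary.comp_vars {ι : Type} {P : (Fin n → M) → (Fin n → M) → unitInterval}
    (hP : IsDefinableBinary L A P) (f g : Fin n → ι) :
    IsDefinablePredicate L A (fun x : ι → M => P (x ∘ f) (x ∘ g)) :=
  IsDefinablePredicate.comp_vars hP (Sum.elim f g)

/-- The maximum metric on tuples. -/
noncomputable def tupleDist (x y : Fin n → M) : unitInterval :=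
  Finset.univ.sup fun i => clip (dist (x i) (y i))

variable (L A) in
theorem isDefinableBinary_tupleDist :
    IsDefinableBinary L A (tupleDist : (Fin n → M) → (Fin n → M) → unitInterval) :=
  IsDefinablePredicate.finset_sup Finset.univ fun i _ =>
    IsDefinablePredicate.dist_vars (Sum.inl i) (Sum.inr i)

theorem eq_of_forall_tupleDist_le (L : Signature.{u, v}) {M : Type w} [MetricSpace M]
    [Structure L M] {n : ℕ} {x y : Fin n → M}
    (h : ∀ ε : ℝ, 0 < ε → (tupleDist x y : ℝ) ≤ ε) : x = y := by
  funext i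
  refine eq_of_forall_dist_le fun ε hε => ?_
  have h1 : clip (dist (x i) (y i)) ≤ tupleDist x y :=
    Finset.le_sup (f := fun i => clip (dist (x i) (y i))) (Finset.mem_univ i)
  have h2 := (Subtype.coe_le_coe.2 h1).trans (h ε hε)
  rwa [coe_clip_of_nonneg dist_nonneg, min_eq_right (Structure.dist_le_one L _ _)] at h2

theorem tupleDist_isPseudoMetric (L : Signature.{u, v}) {M : Type w} [MetricSpace M]
    [Structure L M] {n : ℕ} :
    IsPseudoMetric (tupleDist : (Fin n → M) → (Fin n → M) → unitInterval) where
  self x := by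
    refine le_antisymm (Finset.sup_le fun i _ => ?_) unitInterval.nonneg'
    rw [dist_self]
    exact (clip_coe 0).le
  comm x y := by simp only [tupleDist, dist_comm]
  triangle x y z := by
    have h : tupleDist x z ≤ clip (tupleDist x y + tupleDist y z) := by
      refine Finset.sup_le fun i _ => Set.monotone_projIcc zero_le_one ?_
      have coe_le : ∀ x y : Fin n → M, dist (x i) (y i) ≤ tupleDist x y := fun x y => by
        have h1 : clip (dist (x i) (y i)) ≤ tupleDist x y :=
          Finset.le_sup (f := fun i => clip (dist (x i) (y i))) (Finset.mem_univ i)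
        have h2 := Subtype.coe_le_coe.2 h1
        rwa [coe_clip_of_nonneg dist_nonneg, min_eq_right (Structure.dist_le_one L _ _)] at h2
      exact (dist_triangle _ (y i) _).trans (add_le_add (coe_le x y) (coe_le y z))
    refine (Subtype.coe_le_coe.2 h).trans ?_
    rw [coe_clip_of_nonneg (add_nonneg (unitInterval.nonneg _) (unitInterval.nonneg _))]
    exact min_le_right _ _

theorem exists_pow_half_le_lt {t : ℝ} (h0 : 0 < t) (h1 : t < 1) :
    ∃ k : ℕ, (1 / 2) ^ (k + 1) ≤ t ∧ t < (1 / 2) ^ k := by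
  classical
  have hex : ∃ k : ℕ, ((1 : ℝ) / 2) ^ (k + 1) ≤ t := by
    obtain ⟨k, hk⟩ := exists_pow_lt_of_lt_one h0 (by norm_num : (1 / 2 : ℝ) < 1)
    exact ⟨k, (pow_le_pow_of_le_one (by norm_num) (by norm_num) k.le_succ).trans hk.le⟩
  refine ⟨Nat.find hex, Nat.find_spec hex, ?_⟩
  rcases h : Nat.find hex with _ | k
  · simpa using h1
  · exact not_le.1 (Nat.find_min hex (m := k) (by omega))

/-- Near a type-definable set on which `P` satisfies the triangle inequality, the defect in the
triangle inequality is small in comparison with the distance to the set, as measured by a suitable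
definable predicate. -/
theorem IsSaturated.exists_triangle_defect_le_sq
    (hM : IsSaturated L M (Order.succ (max (Cardinal.mk A) Cardinal.aleph0)))
    (Γ : Set (FormulaOver L A (Fin n))) {P : (Fin n → M) → (Fin n → M) → unitInterval}
    (hP : IsDefinableBinary L A P)
    (htri : ∀ x y z, (∀ φ ∈ Γ, φ.val x = 0) → (∀ φ ∈ Γ, φ.val y = 0) →
      (∀ φ ∈ Γ, φ.val z = 0) → (P x z : ℝ) ≤ P x y + P y z) :
    ∃ θ : (Fin n → M) → unitInterval, IsDefinablePredicate L A θ ∧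
      (∀ x, (∀ φ ∈ Γ, φ.val x = 0) → θ x = 0) ∧
      ∀ x y z (t : ℝ), (θ x : ℝ) ≤ t → (θ y : ℝ) ≤ t → (θ z : ℝ) ≤ t → t < 1 →
        (P x z : ℝ) ≤ P x y + P y z + t ^ 2 := by
  let G : (Fin 3 × Fin n → M) → unitInterval := fun x =>
    clip (P (fun i => x (0, i)) (fun i => x (2, i)) - P (fun i => x (0, i)) (fun i => x (1, i))
      - P (fun i => x (1, i)) (fun i => x (2, i)))
  have hG : IsDefinablePredicate L A G := by
    refine IsDefinablePredicate.clip_comp (k := 3) (P := ![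
      fun x => P (fun i => x (0, i)) (fun i => x (2, i)),
      fun x => P (fun i => x (0, i)) (fun i => x (1, i)),
      fun x => P (fun i => x (1, i)) (fun i => x (2, i))]) ?_
      (g := fun t => t 0 - t 1 - t 2) (by fun_prop)
    intro i
    fin_cases i
    · exact hP.comp_vars (fun i => (0, i)) (fun i => (2, i))
    · exact hP.comp_vars (fun i => (0, i)) (fun i => (1, i))
    · exact hP.comp_vars (fun i => (1, i)) (fun i => (2, i))
  have hG0 : ∀ x : Fin 3 × Fin n → M,
      (∀ i, ∀ φ ∈ Γ, φ.val (fun l => x (i, l)) = 0) → (0 : unitInterval) = 0 → G x = 0 :=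
    fun x hx _ => Set.projIcc_of_le_left _
      (by linarith [htri _ _ _ (hx 0) (hx 1) (hx 2)])
  -- The `k`-th estimate serves `(1 / 2) ^ (k + 1) ≤ t < (1 / 2) ^ k`. The extra factor `1 / 2`
  -- keeps the bound below `1`, where truncation loses nothing.
  choose F δ hδ hF using fun k : ℕ => hM.exists_finset_le_triple Γ
    (H := fun _ => 0) (IsDefinablePredicate.const 0) hG hG0
    (ε := ((1 / 2) ^ (k + 1)) ^ 2 / 2) (by positivity)
  obtain ⟨θ, hθ, hθ0, hθF⟩ := exists_definable_sublevel_subset Γ F δ hδ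
  refine ⟨θ, hθ, hθ0, fun x y z t hx hy hz ht => ?_⟩
  have key : ∀ k : ℕ, t < (1 / 2) ^ k →
      (P x z : ℝ) ≤ P x y + P y z + ((1 / 2) ^ (k + 1)) ^ 2 := by
    intro k hk
    have h := hF k (fun p => ![x, y, z] p.1 p.2) (fun i φ hφ => by
      fin_cases i
      · exact hθF k x (hx.trans_lt hk) φ hφ
      · exact hθF k y (hy.trans_lt hk) φ hφ
      · exact hθF k z (hz.trans_lt hk) φ hφ) rfl
    change (clip ((P x z : ℝ) - P x y - P y z) : ℝ) ≤ _ at h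
    rw [coe_clip] at h
    have hk1 : (((1 : ℝ) / 2) ^ (k + 1)) ^ 2 ≤ 1 :=
      pow_le_one₀ (by positivity) (pow_le_one₀ (by norm_num) (by norm_num))
    have hk0 : (0 : ℝ) < ((1 / 2) ^ (k + 1)) ^ 2 := by positivity
    rcases min_le_iff.1 ((le_max_right _ _).trans h) with h | h <;> linarith
  rcases ((unitInterval.nonneg (θ x)).trans hx).lt_or_eq with h0 | h0
  · obtain ⟨k, hk1, hk2⟩ := exists_pow_half_le_lt h0 ht
    linarith [key k hk2, pow_le_pow_left₀ (by positivity) hk1 2]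
  -- For `t = 0` all the estimates apply, and their bounds tend to `0`.
  · refine le_of_forall_pos_le_add fun η hη => ?_
    obtain ⟨k, hk⟩ := exists_pow_lt_of_lt_one hη (by norm_num : (1 / 2 : ℝ) < 1)
    have h1 := key k (by rw [← h0]; positivity)
    have h2 : (((1 : ℝ) / 2) ^ (k + 1)) ^ 2 ≤ (1 / 2) ^ k := by
      rw [← pow_mul]
      exact pow_le_pow_of_le_one (by norm_num) (by norm_num) (by omega)
    rw [← h0]
    linarith

/-- If `P` separates the points of a type-definable set, then it also separates the points of the
zero set of a definable predicate that vanishes on that set. -/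
theorem IsSaturated.exists_separated_zero_set
    (hM : IsSaturated L M (Order.succ (max (Cardinal.mk A) Cardinal.aleph0)))
    (Γ : Set (FormulaOver L A (Fin n))) {P : (Fin n → M) → (Fin n → M) → unitInterval}
    (hP : IsDefinableBinary L A P)
    (hsep : ∀ x y, (∀ φ ∈ Γ, φ.val x = 0) → (∀ φ ∈ Γ, φ.val y = 0) → P x y = 0 → x = y) :
    ∃ θ : (Fin n → M) → unitInterval, IsDefinablePredicate L A θ ∧
      (∀ x, (∀ φ ∈ Γ, φ.val x = 0) → θ x = 0) ∧
      ∀ x y, θ x = 0 → θ y = 0 → P x y = 0 → x = y := by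
  let G : (Fin 3 × Fin n → M) → unitInterval := fun x =>
    tupleDist (fun i => x (0, i)) (fun i => x (1, i))
  let H : (Fin 3 × Fin n → M) → unitInterval := fun x =>
    P (fun i => x (0, i)) (fun i => x (1, i))
  have hG : IsDefinablePredicate L A G :=
    (isDefinableBinary_tupleDist L A).comp_vars (fun i => (0, i)) (fun i => (1, i))
  have hH : IsDefinablePredicate L A H := hP.comp_vars (fun i => (0, i)) (fun i => (1, i))
  have hG0 : ∀ x : Fin 3 × Fin n → M,
      (∀ i, ∀ φ ∈ Γ, φ.val (fun l => x (i, l)) = 0) → H x = 0 → G x = 0 := by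
    intro x hx hHx
    have h := hsep _ _ (hx 0) (hx 1) hHx
    change tupleDist _ _ = 0
    rw [h]
    exact (tupleDist_isPseudoMetric L).self _
  choose F δ hδ hF using fun k : ℕ => hM.exists_finset_le_triple Γ hH hG hG0
    (ε := (1 / 2) ^ k) (by positivity)
  obtain ⟨θ, hθ, hθ0, hθF⟩ := exists_definable_sublevel_subset Γ F δ hδ
  refine ⟨θ, hθ, hθ0, fun x y hx hy hxy => eq_of_forall_tupleDist_le L fun ε hε => ?_⟩
  obtain ⟨k, hk⟩ := exists_pow_lt_of_lt_one hε (by norm_num : (1 / 2 : ℝ) < 1)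
  have hx' : (θ x : ℝ) < (1 / 2) ^ k := by rw [hx, Set.Icc.coe_zero]; positivity
  have hy' : (θ y : ℝ) < (1 / 2) ^ k := by rw [hy, Set.Icc.coe_zero]; positivity
  -- `G` and `H` ignore the third tuple, so `y` is repeated.
  refine (hF k (fun p => ![x, y, y] p.1 p.2) (fun i φ hφ => ?_) hxy).trans hk.le
  fin_cases i
  · exact hθF k x hx' φ hφ
  · exact hθF k y hy' φ hφ
  · exact hθF k y hy' φ hφ

end Neighbourhood

/-! ### The step length and the pseudo-metric it generates -/

section Generator

variable {Y : Type*} {P : Y → Y → unitInterval} {θ : Y → unitInterval}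
  {D : Y → Y → unitInterval}

/-- A pseudo-metric for which `P` and `θ` are uniformly Lipschitz, up to the summand `D`. -/
noncomputable def stepDist (P : Y → Y → unitInterval) (θ : Y → unitInterval)
    (D : Y → Y → unitInterval) (x y : Y) : ℝ :=
  (⨆ z, clip |(P x z : ℝ) - P y z| : unitInterval) + |(θ x : ℝ) - θ y| + D x y

/-- The length of a step: the distance `P`, where points outside the zero set of `θ` are
penalised, unless the points are very close to each other. -/
noncomputable def stepLength (P : Y → Y → unitInterval) (θ : Y → unitInterval)
    (D : Y → Y → unitInterval) (x y : Y) : unitInterval :=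
  clip (min (stepDist P θ D x y) (P x y + θ x + θ y))

theorem le_iSup_clip (f : Y → ℝ) (hf : ∀ y, f y ≤ 1) (z : Y) :
    f z ≤ (⨆ z, clip (f z) : unitInterval) := by
  have h : (clip (f z) : ℝ) ≤ (⨆ z, clip (f z) : unitInterval) :=
    Subtype.coe_le_coe.2 (le_iSup (fun z => clip (f z)) z)
  rw [coe_clip, min_eq_right (hf z)] at h
  exact (le_max_right _ _).trans h

theorem abs_sub_le_one (s t : unitInterval) : |(s : ℝ) - t| ≤ 1 := by
  rw [abs_le]
  constructor <;> linarith [unitInterval.nonneg s, unitInterval.nonneg t,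
    unitInterval.le_one s, unitInterval.le_one t]

theorem le_add_stepDist (x y z : Y) : (P x z : ℝ) + θ x ≤ P y z + θ y + stepDist P θ D x y := by
  have h := le_iSup_clip (fun z => |(P x z : ℝ) - P y z|) (fun z => abs_sub_le_one _ _) z
  have h1 := le_abs_self ((P x z : ℝ) - P y z)
  have h2 := le_abs_self ((θ x : ℝ) - θ y)
  have h3 := unitInterval.nonneg (D x y)
  unfold stepDist
  linarith

theorem le_add_stepDist_left (x y z : Y) : (P x z : ℝ) ≤ P y z + stepDist P θ D x y := by
  have h := le_iSup_clip (fun z => |(P x z : ℝ) - P y z|) (fun z => abs_sub_le_one _ _) z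
  have h1 := le_abs_self ((P x z : ℝ) - P y z)
  have h2 := abs_nonneg ((θ x : ℝ) - θ y)
  have h3 := unitInterval.nonneg (D x y)
  unfold stepDist
  linarith

theorem stepDist_nonneg (x y : Y) : 0 ≤ stepDist P θ D x y :=
  add_nonneg (add_nonneg (unitInterval.nonneg _) (abs_nonneg _)) (unitInterval.nonneg _)

theorem le_stepDist (x y : Y) : (D x y : ℝ) ≤ stepDist P θ D x y :=
  le_add_of_nonneg_left (add_nonneg (unitInterval.nonneg _) (abs_nonneg _))

theorem stepDist_comm (hD : IsPseudoMetric D) (x y : Y) :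
    stepDist P θ D x y = stepDist P θ D y x := by
  unfold stepDist
  rw [hD.comm x y, abs_sub_comm (θ x : ℝ)]
  simp only [abs_sub_comm (P x _ : ℝ)]

theorem stepDist_self (hD : IsPseudoMetric D) (x : Y) : stepDist P θ D x x = 0 := by
  have h : clip 0 = 0 := clip_coe 0
  have : Nonempty Y := ⟨x⟩
  simp [stepDist, hD.self, h]

theorem stepDist_triangle (hD : IsPseudoMetric D) (x y z : Y) :
    stepDist P θ D x z ≤ stepDist P θ D x y + stepDist P θ D y z := by
  have h1 : (⨆ w, clip |(P x w : ℝ) - P z w|) ≤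
      clip ((⨆ w, clip |(P x w : ℝ) - P y w| : unitInterval)
        + (⨆ w, clip |(P y w : ℝ) - P z w| : unitInterval)) := by
    refine iSup_le fun w => Set.monotone_projIcc zero_le_one ?_
    have hx := le_iSup_clip (fun w => |(P x w : ℝ) - P y w|) (fun w => abs_sub_le_one _ _) w
    have hz := le_iSup_clip (fun w => |(P y w : ℝ) - P z w|) (fun w => abs_sub_le_one _ _) w
    exact (abs_sub_le _ (P y w : ℝ) _).trans (add_le_add hx hz)
  have h2 := Subtype.coe_le_coe.2 h1
  rw [coe_clip_of_nonneg (add_nonneg (unitInterval.nonneg _) (unitInterval.nonneg _))] at h2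
  have h3 := h2.trans (min_le_right _ _)
  have h4 := abs_sub_le (θ x : ℝ) (θ y) (θ z)
  have h5 := hD.triangle x y z
  unfold stepDist
  linarith

theorem coe_stepLength (x y : Y) : (stepLength P θ D x y : ℝ) =
    min 1 (min (stepDist P θ D x y) (P x y + θ x + θ y)) :=
  coe_clip_of_nonneg (le_min (stepDist_nonneg x y) (add_nonneg
    (add_nonneg (unitInterval.nonneg _) (unitInterval.nonneg _)) (unitInterval.nonneg _)))

theorem stepLength_cases (x y : Y) : (stepLength P θ D x y : ℝ) = 1 ∨
    (stepLength P θ D x y : ℝ) = stepDist P θ D x y ∨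
    (stepLength P θ D x y : ℝ) = P x y + θ x + θ y ∧ (P x y : ℝ) + θ x + θ y < 1 := by
  rw [coe_stepLength]
  rcases le_total (stepDist P θ D x y) (P x y + θ x + θ y) with h | h
  · rw [min_eq_left h]
    rcases min_choice 1 (stepDist P θ D x y) with h | h <;> simp [h]
  · rw [min_eq_right h]
    rcases lt_or_ge ((P x y : ℝ) + θ x + θ y) 1 with h1 | h1
    · exact Or.inr (Or.inr ⟨min_eq_right h1.le, h1⟩)
    · exact Or.inl (min_eq_left h1)

theorem stepLength_le_stepDist (x y : Y) :
    (stepLength P θ D x y : ℝ) ≤ stepDist P θ D x y := by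
  rw [coe_stepLength]
  exact (min_le_right _ _).trans (min_le_left _ _)

theorem stepLength_le_add (x y : Y) :
    (stepLength P θ D x y : ℝ) ≤ P x y + θ x + θ y := by
  rw [coe_stepLength]
  exact (min_le_right _ _).trans (min_le_right _ _)

/-- Two `stepDist` steps satisfy the triangle inequality exactly, and so do mixed pairs, by the
Lipschitz property of `P` and `θ`. For two `P`-steps, `θ` at all three points is at most the longer
step, so `htri` applies with that length as `t`. -/
theorem isAlmostPseudoMetric_stepLength (hD : IsPseudoMetric D) (hP : ∀ x y, P x y = P y x)
    (htri : ∀ x y z (t : ℝ), (θ x : ℝ) ≤ t → (θ y : ℝ) ≤ t → (θ z : ℝ) ≤ t → t < 1 →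
      (P x z : ℝ) ≤ P x y + P y z + t ^ 2) :
    IsAlmostPseudoMetric (stepLength P θ D) where
  self x := by
    refine le_antisymm (Subtype.coe_le_coe.1 ?_) unitInterval.nonneg'
    exact (stepLength_le_stepDist x x).trans_eq (stepDist_self hD x)
  comm x y := by
    unfold stepLength
    rw [stepDist_comm hD x y, hP x y, add_right_comm]
  triangle x y z := by
    have hsq := sq_nonneg (max (stepLength P θ D x y : ℝ) (stepLength P θ D y z))
    have hxy := unitInterval.nonneg (stepLength P θ D x y)
    have hyz := unitInterval.nonneg (stepLength P θ D y z)
    have hle := unitInterval.le_one (stepLength P θ D x z)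
    have hd := stepLength_le_stepDist (P := P) (θ := θ) (D := D) x z
    have ha := stepLength_le_add (P := P) (θ := θ) (D := D) x z
    rcases stepLength_cases (P := P) (θ := θ) (D := D) x y with h1 | h1 | ⟨h1, h1'⟩
    · linarith
    · rcases stepLength_cases (P := P) (θ := θ) (D := D) y z with h2 | h2 | ⟨h2, -⟩
      · linarith
      · linarith [stepDist_triangle (P := P) (θ := θ) hD x y z]
      · linarith [le_add_stepDist (P := P) (θ := θ) (D := D) x y z]
    · rcases stepLength_cases (P := P) (θ := θ) (D := D) y z with h2 | h2 | ⟨h2, h2'⟩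
      · linarith
      · have h := le_add_stepDist (P := P) (θ := θ) (D := D) z y x
        rw [stepDist_comm hD, hP z x, hP y x] at h
        linarith
      · have p1 := unitInterval.nonneg (P x y)
        have p2 := unitInterval.nonneg (P y z)
        have t1 := unitInterval.nonneg (θ x)
        have t2 := unitInterval.nonneg (θ y)
        have t3 := unitInterval.nonneg (θ z)
        have m1 := le_max_left (stepLength P θ D x y : ℝ) (stepLength P θ D y z)
        have m2 := le_max_right (stepLength P θ D x y : ℝ) (stepLength P θ D y z)
        have m3 : max (stepLength P θ D x y : ℝ) (stepLength P θ D y z) < 1 :=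
          max_lt (by linarith) (by linarith)
        linarith [htri x y z _ (by linarith) (by linarith) (by linarith) m3]

/-- For a `P`-step the defect is at most `(θ y + θ z) ^ 2`. As `θ y + θ z < 1`, the penalty `θ y + θ
z` absorbs it. -/
theorem le_add_stepLength (hD : IsPseudoMetric D) (hP : ∀ x y, P x y = P y x)
    (htri : ∀ x y z (t : ℝ), (θ x : ℝ) ≤ t → (θ y : ℝ) ≤ t → (θ z : ℝ) ≤ t → t < 1 →
      (P x z : ℝ) ≤ P x y + P y z + t ^ 2) {x : Y} (hx : θ x = 0) (y z : Y) :
    (P x z : ℝ) ≤ P x y + stepLength P θ D y z := by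
  have hxy := unitInterval.nonneg (P x y)
  rcases stepLength_cases (P := P) (θ := θ) (D := D) y z with h | h | ⟨h, h'⟩
  · linarith [unitInterval.le_one (P x z)]
  · have h1 := le_add_stepDist_left (P := P) (θ := θ) (D := D) z y x
    rw [stepDist_comm hD, hP z x, hP y x] at h1
    linarith
  · have p := unitInterval.nonneg (P y z)
    have t1 := unitInterval.nonneg (θ y)
    have t2 := unitInterval.nonneg (θ z)
    have h1 := htri x y z (θ y + θ z) (by rw [hx, Set.Icc.coe_zero]; linarith) (by linarith)
      (by linarith) (by linarith)
    nlinarith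

theorem chainDist_stepLength_eq (hD : IsPseudoMetric D) (hP : ∀ x y, P x y = P y x)
    (htri : ∀ x y z (t : ℝ), (θ x : ℝ) ≤ t → (θ y : ℝ) ≤ t → (θ z : ℝ) ≤ t → t < 1 →
      (P x z : ℝ) ≤ P x y + P y z + t ^ 2) {x y : Y} (hx : θ x = 0) (hy : θ y = 0)
    (hxx : P x x = 0) : chainDist (stepLength P θ D) x y = P x y := by
  refine le_antisymm (Subtype.coe_le_coe.1 ?_) (Subtype.coe_le_coe.1 ?_)
  · refine (chainDist_le 0 x y).trans ((stepLength_le_add x y).trans_eq ?_)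
    rw [hx, hy, Set.Icc.coe_zero, add_zero, add_zero]
  · have h := le_add_chainDist (le_add_stepLength hD hP htri hx) x y
    rwa [hxx, Set.Icc.coe_zero, zero_add] at h

theorem eq_of_chainDist_stepLength_eq_zero (hD : IsMetric D) (hP : ∀ x y, P x y = P y x)
    (htri : ∀ x y z (t : ℝ), (θ x : ℝ) ≤ t → (θ y : ℝ) ≤ t → (θ z : ℝ) ≤ t → t < 1 →
      (P x z : ℝ) ≤ P x y + P y z + t ^ 2)
    (hsep : ∀ x y, θ x = 0 → θ y = 0 → P x y = 0 → x = y) {x y : Y}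
    (h : chainDist (stepLength P θ D) x y = 0) : x = y := by
  have h0 := congrArg Subtype.val ((isAlmostPseudoMetric_stepLength hD.toIsPseudoMetric hP
    htri).eq_zero_of_chainDist_eq_zero h)
  rw [Set.Icc.coe_zero] at h0
  have zero : ∀ s : unitInterval, (s : ℝ) ≤ 0 → s = 0 := fun s hs =>
    le_antisymm (Subtype.coe_le_coe.1 hs) unitInterval.nonneg'
  rcases stepLength_cases (P := P) (θ := θ) (D := D) x y with h1 | h1 | ⟨h1, -⟩
  · linarith
  · exact hD.eq_of_zero x y (zero _ (by linarith [le_stepDist (P := P) (θ := θ) (D := D) x y]))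
  · have p := unitInterval.nonneg (P x y)
    have t1 := unitInterval.nonneg (θ x)
    have t2 := unitInterval.nonneg (θ y)
    exact hsep x y (zero _ (by linarith)) (zero _ (by linarith)) (zero _ (by linarith))

end Generator

/-! ### Definability of the extension -/

section Definability

variable {L : Signature.{u, v}} {M : Type w} [MetricSpace M] [Structure L M]
variable {A : Set M} {n : ℕ}

theorem isDefinableBinary_stepLength {P D : (Fin n → M) → (Fin n → M) → unitInterval}
    {θ : (Fin n → M) → unitInterval} (hP : IsDefinableBinary L A P)
    (hD : IsDefinableBinary L A D) (hθ : IsDefinablePredicate L A θ) :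
    IsDefinableBinary L A (stepLength P θ D) := by
  have hS : IsDefinablePredicate L A (fun z : Fin n ⊕ Fin n → M =>
      ⨆ w, clip |(P (fun i => z (Sum.inl i)) w : ℝ) - P (fun i => z (Sum.inr i)) w|) := by
    refine IsDefinablePredicate.iSup (P := fun z : (Fin n ⊕ Fin n) ⊕ Fin n → M =>
      clip |(P (z ∘ fun i => Sum.inl (Sum.inl i)) (z ∘ Sum.inr) : ℝ) -
        P (z ∘ fun i => Sum.inl (Sum.inr i)) (z ∘ Sum.inr)|) ?_
    exact (hP.comp_vars _ _).clip_comp₂ (hP.comp_vars _ _) (g := fun s t => |s - t|)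
      (by unfold Function.uncurry; fun_prop)
  refine IsDefinablePredicate.clip_comp (k := 5) (P := ![
      fun z => ⨆ w, clip |(P (fun i => z (Sum.inl i)) w : ℝ) - P (fun i => z (Sum.inr i)) w|,
      fun z => θ fun i => z (Sum.inl i),
      fun z => θ fun i => z (Sum.inr i),
      fun z => D (fun i => z (Sum.inl i)) (fun i => z (Sum.inr i)),
      fun z => P (fun i => z (Sum.inl i)) (fun i => z (Sum.inr i))]) ?_
    (g := fun t => min (t 0 + |t 1 - t 2| + t 3) (t 4 + t 1 + t 2)) (by fun_prop)
  intro i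
  fin_cases i
  · exact hS
  · exact hθ.comp_vars Sum.inl
  · exact hθ.comp_vars Sum.inr
  · exact hD
  · exact hP

theorem isDefinableBinary_chainInf {Q : (Fin n → M) → (Fin n → M) → unitInterval}
    (hQ : IsDefinableBinary L A Q) (m : ℕ) : IsDefinableBinary L A (chainInf Q m) := by
  induction m with
  | zero => exact hQ
  | succ m ih =>
    refine IsDefinablePredicate.iInf (P := fun z : (Fin n ⊕ Fin n) ⊕ Fin n → M =>
      clip (chainInf Q m (z ∘ fun i => Sum.inl (Sum.inl i)) (z ∘ Sum.inr) +
        Q (z ∘ Sum.inr) (z ∘ fun i => Sum.inl (Sum.inr i)))) ?_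
    exact (ih.comp_vars _ _).clip_comp₂ (hQ.comp_vars _ _) (g := fun s t => s + t)
      (by unfold Function.uncurry; fun_prop)

theorem isDefinableBinary_chainDist {Q : (Fin n → M) → (Fin n → M) → unitInterval}
    (hQ : IsDefinableBinary L A Q) (h : IsAlmostPseudoMetric Q) :
    IsDefinableBinary L A (chainDist Q) := by
  refine IsDefinablePredicate.of_uniform_limit fun ε hε => ?_
  obtain ⟨m, hm⟩ := exists_nat_gt (8 / ε)
  refine ⟨_, isDefinableBinary_chainInf hQ m, fun z => ?_⟩
  have h1 := h.chainInf_le_chainDist_add m (fun i => z (Sum.inl i)) (fun i => z (Sum.inr i))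
  have h2 := chainDist_le (Q := Q) m (fun i => z (Sum.inl i)) (fun i => z (Sum.inr i))
  have h3 : 8 / ((m : ℝ) + 1) ≤ ε := by
    rw [div_lt_iff₀ hε] at hm
    rw [div_le_iff₀ (by positivity)]
    nlinarith
  rw [Subtype.dist_eq, Real.dist_eq, abs_le]
  constructor <;> linarith

theorem tupleDist_isMetric (L : Signature.{u, v}) {M : Type w} [MetricSpace M]
    [Structure L M] {n : ℕ} :
    IsMetric (tupleDist : (Fin n → M) → (Fin n → M) → unitInterval) where
  toIsPseudoMetric := tupleDist_isPseudoMetric L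
  eq_of_zero x y h := eq_of_forall_tupleDist_le L fun ε hε => by
    rw [h, Set.Icc.coe_zero]; exact hε.le

/-- A definable pseudo-metric on a type-definable set extends to a total definable pseudo-metric,
which can be taken to be a metric if the given one is. -/
theorem IsSaturated.exists_extension
    (hM : IsSaturated L M (Order.succ (max (Cardinal.mk A) Cardinal.aleph0)))
    {X : Set (Fin n → M)} (hX : IsTypeDefinable L A X) {d : X → X → unitInterval}
    (hd : IsPartialDefinableBinary L A d) (hd' : IsPseudoMetric d) :
    ∃ d' : (Fin n → M) → (Fin n → M) → unitInterval, IsDefinableBinary L A d' ∧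
      IsPseudoMetric d' ∧ (IsMetric d → IsMetric d') ∧ ∀ x y : X, d' x y = d x y := by
  obtain ⟨Γ, rfl⟩ := hX
  obtain ⟨P₀, hP₀, hPd₀⟩ := hd
  -- Symmetrising changes nothing on `X`, where the values are already symmetric.
  let P : (Fin n → M) → (Fin n → M) → unitInterval := fun x y => P₀ x y ⊔ P₀ y x
  have hP : IsDefinableBinary L A P :=
    IsDefinablePredicate.sup hP₀ (hP₀.comp_vars Sum.inr Sum.inl)
  have hcomm : ∀ x y, P x y = P y x := fun x y => sup_comm _ _
  have hPd : ∀ (x y : Fin n → M) (hx : ∀ φ ∈ Γ, φ.val x = 0) (hy : ∀ φ ∈ Γ, φ.val y = 0),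
      P x y = d ⟨x, hx⟩ ⟨y, hy⟩ := fun x y hx hy => by
    change P₀ x y ⊔ P₀ y x = _
    rw [hPd₀ ⟨x, hx⟩ ⟨y, hy⟩, hPd₀ ⟨y, hy⟩ ⟨x, hx⟩, hd'.comm ⟨y, hy⟩, sup_idem]
  obtain ⟨θ₁, hθ₁, hθ₁X, htri₁⟩ := hM.exists_triangle_defect_le_sq Γ hP
    fun x y z hx hy hz => by
      rw [hPd x z hx hz, hPd x y hx hy, hPd y z hy hz]; exact hd'.triangle _ _ _
  obtain ⟨θ₂, hθ₂, hθ₂X, hsep₂⟩ : ∃ θ : (Fin n → M) → unitInterval,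
      IsDefinablePredicate L A θ ∧ (∀ x, (∀ φ ∈ Γ, φ.val x = 0) → θ x = 0) ∧
      (IsMetric d → ∀ x y, θ x = 0 → θ y = 0 → P x y = 0 → x = y) := by
    by_cases hmet : IsMetric d
    · obtain ⟨θ, h1, h2, h3⟩ := hM.exists_separated_zero_set Γ hP fun x y hx hy hxy => by
        rw [hPd x y hx hy] at hxy
        exact congrArg Subtype.val (hmet.eq_of_zero _ _ hxy)
      exact ⟨θ, h1, h2, fun _ => h3⟩
    · exact ⟨fun _ => 0, IsDefinablePredicate.const 0, fun _ _ => rfl, fun h => (hmet h).elim⟩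
  -- Both properties survive enlarging `θ`: its sublevel sets shrink, and its zeros are the common
  -- zeros of `θ₁` and `θ₂`.
  let θ : (Fin n → M) → unitInterval := fun x => θ₁ x ⊔ θ₂ x
  have hθ : IsDefinablePredicate L A θ := hθ₁.sup hθ₂
  have hle₁ : ∀ x, (θ₁ x : ℝ) ≤ θ x := fun x =>
    Subtype.coe_le_coe.2 (le_sup_left : θ₁ x ≤ θ₁ x ⊔ θ₂ x)
  have hle₂ : ∀ x, θ₂ x ≤ θ x := fun x => le_sup_right
  have hθX : ∀ x, (∀ φ ∈ Γ, φ.val x = 0) → θ x = 0 := fun x hx => by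
    change θ₁ x ⊔ θ₂ x = 0
    rw [hθ₁X x hx, hθ₂X x hx, sup_idem]
  have htri : ∀ x y z (t : ℝ), (θ x : ℝ) ≤ t → (θ y : ℝ) ≤ t → (θ z : ℝ) ≤ t → t < 1 →
      (P x z : ℝ) ≤ P x y + P y z + t ^ 2 := fun x y z t hx hy hz =>
    htri₁ x y z t ((hle₁ x).trans hx) ((hle₁ y).trans hy) ((hle₁ z).trans hz)
  have hD := tupleDist_isMetric L (M := M) (n := n)
  have hQ := isAlmostPseudoMetric_stepLength hD.toIsPseudoMetric hcomm htri
  refine ⟨chainDist (stepLength P θ tupleDist), isDefinableBinary_chainDist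
    (isDefinableBinary_stepLength hP (isDefinableBinary_tupleDist L A) hθ) hQ,
    hQ.isPseudoMetric_chainDist, fun hmet => ⟨hQ.isPseudoMetric_chainDist, fun x y hxy => ?_⟩,
    fun x y => ?_⟩
  · refine eq_of_chainDist_stepLength_eq_zero hD hcomm htri (fun x y hx hy => ?_) hxy
    exact hsep₂ hmet x y (le_antisymm ((hle₂ x).trans hx.le) unitInterval.nonneg')
      (le_antisymm ((hle₂ y).trans hy.le) unitInterval.nonneg')
  · rw [chainDist_stepLength_eq hD.toIsPseudoMetric hcomm htri (hθX x x.2) (hθX y y.2)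
      ((hPd x x x.2 x.2).trans (hd'.self _)), hPd x y x.2 y.2]

end Definability

end ContLogic

theorem theorem3p12 {L : ContLogic.Signature.{u, v}} {M : Type w} [MetricSpace M]
    [ContLogic.Structure L M] (A : Set M)
    (hM : ContLogic.IsSaturated L M (Order.succ (max (Cardinal.mk A) Cardinal.aleph0)))
    {n : ℕ} (X : Set (Fin n → M)) (hX : ContLogic.IsTypeDefinable L A X)
    (d₁ : X → X → unitInterval) (hd₁ : ContLogic.IsPartialDefinableBinary L A d₁) :
    (ContLogic.IsPseudoMetric d₁ →
      ∃ (d₂ : (Fin n → M) → (Fin n → M) → unitInterval) (h : unitInterval → unitInterval),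
        ContLogic.IsDefinableBinary L A d₂ ∧ ContLogic.IsPseudoMetric d₂ ∧
        Continuous h ∧ Monotone h ∧ h 0 = 0 ∧ (∀ t, t ≤ h t) ∧
        ∀ x y : X, d₂ x y = h (d₁ x y)) ∧
    (ContLogic.IsMetric d₁ →
      ∃ (d₂ : (Fin n → M) → (Fin n → M) → unitInterval) (h : unitInterval → unitInterval),
        ContLogic.IsDefinableBinary L A d₂ ∧ ContLogic.IsMetric d₂ ∧
        Continuous h ∧ Monotone h ∧ h 0 = 0 ∧ (∀ t, t ≤ h t) ∧
        ∀ x y : X, d₂ x y = h (d₁ x y)) := by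
  refine ⟨fun hd => ?_, fun hd => ?_⟩
  · obtain ⟨d₂, hdef, hpm, -, hext⟩ := hM.exists_extension hX hd₁ hd
    exact ⟨d₂, id, hdef, hpm, continuous_id, monotone_id, rfl, fun _ => le_rfl, hext⟩
  · obtain ⟨d₂, hdef, -, hm, hext⟩ := hM.exists_extension hX hd₁ hd.toIsPseudoMetric
    exact ⟨d₂, id, hdef, hm hd, continuous_id, monotone_id, rfl, fun _ => le_rfl, hext⟩
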